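/- Let $r\ge 1$ be a fixed integer. For every $n=1,2,\dots$ let $(X_{n,t})_{t=1}^{\infty}$ be a strictly stationary sequence of real random variables (its law and its probability space may depend on $n$), with coefficients of absolute regularity $$\beta_n(m)=\sup_{k\ge 1}\mathbf{E}\Big\{\sup_{A\in\sigma(X_{n,k+m},X_{n,k+m+1},\dots)}\big|\mathbf{P}\{A\mid X_{n,1},\dots,X_{n,k}\}-\mathbf{P}\{A\}\big|\Big\},$$ where $\mathbf P\{\cdot\mid\cdot\}$ is a regular conditional probability (by stationarity, $\beta_n(m)$ is the coefficient between $\sigma(X_{n,t},\,t\le 0)$ and $\sigma(X_{n,t},\,t\ge m)$ for the two-sided stationary extension of the sequence). Assume that for every $n$ the sequence is absolutely regular, i.e. $\beta_n(m)\to 0$ as $m\to\infty$. For every $n$ and all $1\le j_1<\dots<j_r\le n$ let $f_{n;j_1,\dots,j_r}:\mathbb{R}^r\to\mathbb{R}$ be a measurable function with $|f_{n;j_1,\dots,j_r}|\le F_n<\infty$, and let $$U_n=\sum_{1\le j_1<\dots<j_r\le n}f_{n;j_1,\dots,j_r}(X_{n,j_1},\dots,X_{n,j_r}),\qquad U_n^*=\frac{U_n-\mathbf{E}U_n}{\sqrt{\mathbf{D}U_n}},$$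 where $\mathbf{D}U_n$ is the variance of $U_n$; assume that $\mathbf{D}U_n>0$ for all sufficiently large $n$. Suppose that there are positive integers $m_n$ and a number $b_0\in(0,2/3]$ such that for all $b\in(0,b_0]$, as $n\to\infty$, $$\frac{F_n^2\,m_n^{2-b}\,n^{2(r-1)+b}\,r^{4-2b}}{\mathbf{D}U_n}+\bigl(\beta_n(m_n)\bigr)^{b}\,\frac{F_n^2\,n^{2r}}{\mathbf{D}U_n}\to 0.$$ Then, as $n\to\infty$, $\mathbf{E}(U_n^*)^k$ converges to the $k$-th moment of the standard normal law $N(0,1)$ for every $k=0,1,2,\dots$, and $\mathbf{P}\{U_n^*\le x\}$ converges to the standard normal distribution function at $x$ for every $x\in\mathbb{R}$. -/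

import Mathlib

open MeasureTheory ProbabilityTheory Filter Topology
open scoped ENNReal

/-- Strict stationarity of a real sequence `(Y t)_{t ≥ 0}`: for all indices `t 0, …, t (k - 1)`
and every shift `τ`, the vectors `(Y (t i + τ))_i` and `(Y (t i))_i` have the same law. -/
def StrictlyStationary {Ω : Type*} [MeasurableSpace Ω] (μ : Measure Ω) (Y : ℕ → Ω → ℝ) : Prop :=
  ∀ (k : ℕ) (t : Fin k → ℕ) (τ : ℕ),
    μ.map (fun ω (i : Fin k) => Y (t i + τ) ω) = μ.map (fun ω (i : Fin k) => Y (t i) ω)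

/-- The past `(Y 0, …, Y k)`; it generates the σ-algebra of the sequence up to time `k`. -/
def pastOf {Ω : Type*} (Y : ℕ → Ω → ℝ) (k : ℕ) (ω : Ω) : Fin (k + 1) → ℝ := fun i => Y i ω

/-- The future `(Y l, Y (l + 1), …)`; it generates the σ-algebra of the sequence from time `l`. -/
def futureOf {Ω : Type*} (Y : ℕ → Ω → ℝ) (l : ℕ) (ω : Ω) : ℕ → ℝ := fun i => Y (l + i) ω

/-- `E sup_A |P(A | Y 0, …, Y k) - P(A)|`, where `A` runs over all events generated by
`Y (k + m), Y (k + m + 1), …`. Such events are the sets `{futureOf Y (k + m) ∈ B}` with `B`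
measurable, and `P(A | Y 0, …, Y k)` is the regular conditional probability, i.e. the
conditional distribution of the future given the past, evaluated at `B`. -/
noncomputable def mixingAt {Ω : Type*} [MeasurableSpace Ω] (μ : Measure Ω) [IsFiniteMeasure μ]
    (Y : ℕ → Ω → ℝ) (k m : ℕ) : ℝ≥0∞ :=
  ∫⁻ ω, ⨆ (B : Set (ℕ → ℝ)) (_ : MeasurableSet B),
    ENNReal.ofReal |(condDistrib (futureOf Y (k + m)) (pastOf Y k) μ (pastOf Y k ω)).real B
      - μ.real (futureOf Y (k + m) ⁻¹' B)| ∂μ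

/-- The coefficient of absolute regularity `β(m)` of a one-sided sequence: the supremum over the
time `k` of the coefficients between `σ(Y 0, …, Y k)` and `σ(Y (k + m), Y (k + m + 1), …)`.
For a stationary sequence this is the coefficient between `σ(Y t, t ≤ 0)` and `σ(Y t, t ≥ m)`
of its two-sided stationary extension. -/
noncomputable def betaCoeff {Ω : Type*} [MeasurableSpace Ω] (μ : Measure Ω) [IsFiniteMeasure μ]
    (Y : ℕ → Ω → ℝ) (m : ℕ) : ℝ :=
  (⨆ k : ℕ, mixingAt μ Y k m).toReal

/-- The absolute regularity condition `β(m) → 0` as `m → ∞`. -/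
def AbsolutelyRegular {Ω : Type*} [MeasurableSpace Ω] (μ : Measure Ω) [IsFiniteMeasure μ]
    (Y : ℕ → Ω → ℝ) : Prop :=
  Tendsto (betaCoeff μ Y) atTop (𝓝 0)

/-- The nonhomogeneous `U`-statistic of order `r` on `Y 0, …, Y (n - 1)`, with kernels `f j`
indexed by the strictly increasing `j : Fin r → Fin n`:
the sum over such `j` of `f j (Y (j 0), …, Y (j (r - 1)))`. -/
noncomputable def uStat {Ω : Type*} {r n : ℕ} (f : (Fin r → Fin n) → (Fin r → ℝ) → ℝ)
    (Y : ℕ → Ω → ℝ) (ω : Ω) : ℝ :=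
  open Classical in
  ∑ j : Fin r → Fin n with StrictMono j, f j (fun i => Y (j i) ω)

/-- The standardization `(Z - E Z) / √(D Z)`. -/
noncomputable def standardize {Ω : Type*} [MeasurableSpace Ω] (μ : Measure Ω) (Z : Ω → ℝ)
    (ω : Ω) : ℝ :=
  (Z ω - ∫ ω', Z ω' ∂μ) / √(variance Z μ)

/-!
The proof is by the method of cumulants. Write `σ² = D U_n`, `β = β_n(m_n)`, and call two index
tuples close if some of their entries are at distance less than `m_n`.

*Decoupling.* The definition of `β` allows the past and the future across one gap of length `m_n`
to be made independent at the cost `2 β`. Cutting repeatedly, bounded functions of two finite sets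
of coordinates at distance at least `m_n`, possibly interlaced, have covariance `O(β)`
(`abs_cov_le`). Stationarity is not needed for this.

*Cumulants.* By Good's formula (`good_formula`), the cumulant of order `s` is `1 / s` times the
`s`-th moment of `∑ a, e(a) Z_a`, with independent copies `Z_a` and the `s`-th roots of unity
`e(a)`. For a sum of kernels it expands over `s`-tuples of kernels. If a tuple splits into two
groups with no close pair across, its contribution would vanish if the groups were independent
(`sum_words_eq_zero_of_factor`), hence it is `O(β)`. There are `O(n^r (m_n n^(r-1))^(s-1))`
other tuples (`card_connectedTuple_le`). So the cumulant of order `s` of `U_n^*` is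
`O((n / m_n) (F_n m_n n^(r-1) / σ)^s + β (F_n n^r / σ)^s)`. Both terms are dominated by powers of
the quantity assumed to vanish: the first one for `s ≥ 2 / b₀` by taking `b = b₀`, the second one
by taking `b ≤ 2 / s`.

*Gaussian limit.* Only cumulants of high order are controlled in this way. By Janson's theorem
(`tendsto_cumulant_zero`) this is enough: after rescaling, limit points of the moment sequences
have finitely many nonzero cumulants, so their moment generating function is `exp P` with a
polynomial `P`. The inequality `|E exp(z Z)| ≤ E exp((re z) Z)` forces `deg P ≤ 2`, which is
Marcinkiewicz' theorem (`cumulant_eq_zero_of_momentLike`). Hence all moments converge to the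
Gaussian ones, and the convergence in law follows by Taylor expansion of the characteristic
function (`tendsto_of_tendsto_moments`).
-/

/-! ### Cumulants of a moment sequence -/

/-- The cumulants `κ₁, κ₂, …` of a moment sequence `m` (with `m 0 = 1`), defined by the recursion
`m (q + 1) = ∑ i ≤ q, (q.choose i) * κ (i + 1) * m (q - i)`; the value at `0` is a dummy. -/
noncomputable def cumulant (m : ℕ → ℝ) : ℕ → ℝ
  | 0 => 0
  | q + 1 => m (q + 1) - ∑ i : Fin q, (q.choose i : ℝ) * cumulant m (i + 1) * m (q - i)

lemma moment_succ {m : ℕ → ℝ} (hm : m 0 = 1) (q : ℕ) :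
    m (q + 1) = ∑ i ∈ Finset.range (q + 1), (q.choose i : ℝ) * cumulant m (i + 1) * m (q - i) := by
  rw [Finset.sum_range_succ, cumulant]
  simp [hm, Finset.sum_range]

lemma cumulant_one (m : ℕ → ℝ) : cumulant m 1 = m 1 := by
  rw [cumulant]; simp

lemma cumulant_two (m : ℕ → ℝ) : cumulant m 2 = m 2 - m 1 ^ 2 := by
  rw [cumulant]; simp [cumulant_one, sq]

lemma cumulant_scale (m : ℕ → ℝ) (c : ℝ) (s : ℕ) :
    cumulant (fun q => c ^ q * m q) s = c ^ s * cumulant m s := by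
  induction s using Nat.strong_induction_on with
  | _ s ih =>
    rcases s with _ | q
    · simp [cumulant]
    · rw [cumulant, cumulant, mul_sub, Finset.mul_sum]
      congr 1
      refine Finset.sum_congr rfl fun i _ => ?_
      rw [ih _ (by omega)]
      have : c ^ (q + 1) = c ^ ((i : ℕ) + 1) * c ^ (q - (i : ℕ)) := by
        rw [← pow_add]; congr 1; omega
      rw [this]; ring

lemma tendsto_cumulant {α : Type*} {l : Filter α} {m : α → ℕ → ℝ} {m' : ℕ → ℝ}
    (h : ∀ q, Tendsto (fun n => m n q) l (𝓝 (m' q))) (s : ℕ) :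
    Tendsto (fun n => cumulant (m n) s) l (𝓝 (cumulant m' s)) := by
  induction s using Nat.strong_induction_on with
  | _ s ih =>
    rcases s with _ | q
    · simp only [cumulant, tendsto_const_nhds]
    · simp only [cumulant.eq_2 _ q]
      exact (h _).sub (tendsto_finsetSum _ fun i _ =>
        (tendsto_const_nhds.mul (ih _ (by omega))).mul (h _))

/-- Convergence of all cumulants forces convergence of all moments. -/
lemma exists_tendsto_moment {α : Type*} {l : Filter α} {m : α → ℕ → ℝ}
    (h0 : ∀ n, m n 0 = 1) {c : ℕ → ℝ}
    (h : ∀ s, 1 ≤ s → Tendsto (fun n => cumulant (m n) s) l (𝓝 (c s))) :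
    ∃ m' : ℕ → ℝ, ∀ q, Tendsto (fun n => m n q) l (𝓝 (m' q)) := by
  suffices ∀ q, ∃ x, Tendsto (fun n => m n q) l (𝓝 x) from ⟨_, fun q => (this q).choose_spec⟩
  intro q
  induction q using Nat.strong_induction_on with
  | _ q ih =>
    rcases q with _ | q
    · exact ⟨1, by simp only [h0, tendsto_const_nhds]⟩
    · choose! x hx using ih
      simp_rw [moment_succ (h0 _)]
      exact ⟨_, tendsto_finsetSum _ fun i _ =>
        (tendsto_const_nhds.mul (h (i + 1) (by omega))).mul (hx _ (by omega))⟩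

/-! ### Good's formula for cumulants -/

open PowerSeries in
lemma derivative_prod_eq_sum {R ι : Type*} [CommRing R] [DecidableEq ι] (S : Finset ι)
    (G : ι → R⟦X⟧) :
    d⁄dX R (∏ a ∈ S, G a) = ∑ b ∈ S, ∏ a ∈ S, if a = b then d⁄dX R (G a) else G a := by
  induction S using Finset.induction_on with
  | empty => simp
  | insert x S hx ih =>
    rw [Finset.prod_insert hx, Derivation.leibniz, ih, Finset.sum_insert hx,
      Finset.prod_insert hx, smul_eq_mul, smul_eq_mul, add_comm, Finset.mul_sum]
    congr 1
    · rw [if_pos rfl, mul_comm]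
      congr 1
      exact Finset.prod_congr rfl fun a ha => by rw [if_neg (by rintro rfl; exact hx ha)]
    · refine Finset.sum_congr rfl fun b hb => ?_
      rw [Finset.prod_insert hx, if_neg (by rintro rfl; exact hx hb)]

open PowerSeries in
lemma derivative_prod_of_log {R ι : Type*} [CommRing R] (S : Finset ι)
    (G L : ι → R⟦X⟧) (h : ∀ a, d⁄dX R (G a) = L a * G a) :
    d⁄dX R (∏ a ∈ S, G a) = (∑ a ∈ S, L a) * ∏ a ∈ S, G a := by
  classical
  induction S using Finset.induction_on with
  | empty => simp
  | insert x S hx ih =>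
    rw [Finset.prod_insert hx, Derivation.leibniz, ih, Finset.sum_insert hx, h]
    simp only [smul_eq_mul]; ring

/-- Exponential generating functions multiply: the sum over all words of length `n` of a product
of letter weights depending on the multiplicities is `n!` times a coefficient of the product. -/
lemma sum_prod_fiber_eq_coeff {A : Type*} [Fintype A] [DecidableEq A] (n : ℕ) (g : A → ℕ → ℂ) :
    ∑ k : Fin n → A, ∏ a, g a (Finset.univ.filter fun i => k i = a).card
      = (n.factorial : ℂ) * PowerSeries.coeff n
          (∏ a, PowerSeries.mk fun p => g a p / (p.factorial : ℂ)) := by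
  induction n generalizing g with
  | zero =>
    simp [map_prod]
  | succ n ih =>
    have h1 : ((n + 1).factorial : ℂ) * PowerSeries.coeff (n + 1)
          (∏ a, PowerSeries.mk fun p => g a p / (p.factorial : ℂ))
        = (n.factorial : ℂ) * PowerSeries.coeff n (PowerSeries.derivative ℂ
          (∏ a, PowerSeries.mk fun p => g a p / (p.factorial : ℂ))) := by
      rw [PowerSeries.coeff_derivative, Nat.factorial_succ]; push_cast; ring
    rw [h1, derivative_prod_eq_sum, map_sum, Finset.mul_sum]
    have h2 : ∀ b : A, (∏ a, if a = b then PowerSeries.derivative ℂ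
          (PowerSeries.mk fun p => g a p / (p.factorial : ℂ))
          else (PowerSeries.mk fun p => g a p / (p.factorial : ℂ)))
        = ∏ a, PowerSeries.mk fun p => (if a = b then g a (p + 1) else g a p) /
            (p.factorial : ℂ) := by
      intro b
      refine Finset.prod_congr rfl fun a _ => ?_
      split_ifs with hab
      · ext p
        rw [PowerSeries.coeff_derivative, PowerSeries.coeff_mk, PowerSeries.coeff_mk,
          Nat.factorial_succ]
        have : ((p : ℂ) + 1) ≠ 0 := by exact_mod_cast Nat.succ_ne_zero p
        have : (p.factorial : ℂ) ≠ 0 := by exact_mod_cast Nat.factorial_ne_zero p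
        push_cast
        field_simp
      · rfl
    simp_rw [h2]
    have h3 := fun b => ih (fun a p => if a = b then g a (p + 1) else g a p)
    simp_rw [← h3]
    rw [← (Fin.consEquiv fun _ : Fin (n + 1) => A).sum_comp, Fintype.sum_prod_type]
    refine Finset.sum_congr rfl fun b _ => Finset.sum_congr rfl fun k _ =>
      Finset.prod_congr rfl fun a _ => ?_
    have key : (Finset.univ.filter fun i => (Fin.cons b k : Fin (n + 1) → A) i = a).card
        = if b = a then (Finset.univ.filter fun i => k i = a).card + 1
          else (Finset.univ.filter fun i => k i = a).card := by
      rw [Fin.card_filter_univ_succ]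
      simp
    change g a (Finset.univ.filter fun i => (Fin.cons b k : Fin (n + 1) → A) i = a).card = _
    rw [key]
    by_cases hab : a = b
    · simp [hab]
    · simp [hab, Ne.symm hab]

/-- **Good's formula**: the cumulant of order `s` is `1 / s` times the moment of order `s` of
`∑ a, e(a) Z a`, where the `Z a` are `s` independent copies of the variable and the `e(a)` are the
`s`-th roots of unity. Here the moment is expanded as a sum over words `k`. -/
theorem good_formula (s : ℕ) [NeZero s] {m : ℕ → ℝ} (hm : m 0 = 1) :
    ∑ k : Fin s → ZMod s, (∏ i, ZMod.stdAddChar (k i)) *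
        ∏ a, (m (Finset.univ.filter fun i => k i = a).card : ℂ)
      = s * cumulant m s := by
  set e : ZMod s → ℂ := fun a => ZMod.stdAddChar a
  -- the moment and cumulant generating series
  set M : PowerSeries ℂ := PowerSeries.mk fun p => (m p : ℂ) / (p.factorial : ℂ)
  set K : PowerSeries ℂ := PowerSeries.mk fun p => (cumulant m (p + 1) : ℂ) / (p.factorial : ℂ)
  have hfac : ∀ p : ℕ, (p.factorial : ℂ) ≠ 0 := fun p => by exact_mod_cast p.factorial_ne_zero
  have hMK : PowerSeries.derivative ℂ M = K * M := by
    ext q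
    rw [PowerSeries.coeff_derivative, PowerSeries.coeff_mul,
      Finset.Nat.sum_antidiagonal_eq_sum_range_succ_mk]
    simp only [M, K, PowerSeries.coeff_mk]
    rw [moment_succ hm, Nat.factorial_succ]
    have : ((q : ℂ) + 1) ≠ 0 := by exact_mod_cast Nat.succ_ne_zero q
    have h1 := hfac q
    push_cast
    rw [div_mul_eq_mul_div, div_eq_iff (by positivity), Finset.sum_mul, Finset.sum_mul]
    refine Finset.sum_congr rfl fun i hi => ?_
    have hi' : i ≤ q := by simpa [Nat.lt_succ_iff] using hi
    rw [Nat.cast_choose ℂ hi']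
    have := hfac i
    have := hfac (q - i)
    field_simp
  have hresc : ∀ (c : ℂ) (G : PowerSeries ℂ), PowerSeries.derivative ℂ (PowerSeries.rescale c G)
      = PowerSeries.C c * PowerSeries.rescale c (PowerSeries.derivative ℂ G) := by
    intro c G
    ext q
    simp only [PowerSeries.coeff_derivative, PowerSeries.coeff_rescale, PowerSeries.coeff_C_mul]
    ring
  have hlhs : ∀ k : Fin s → ZMod s, (∏ i, e (k i)) *
        ∏ a, (m (Finset.univ.filter fun i => k i = a).card : ℂ)
      = ∏ a, (fun a p => e a ^ p * (m p : ℂ)) a (Finset.univ.filter fun i => k i = a).card := by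
    intro k
    rw [Finset.prod_mul_distrib]
    congr 1
    rw [← Finset.prod_fiberwise (s := Finset.univ) (g := k)]
    refine Finset.prod_congr rfl fun a _ => ?_
    rw [Finset.prod_congr rfl (g := fun _ => e a), Finset.prod_const]
    intro i hi
    rw [(Finset.mem_filter.1 hi).2]
  rw [Finset.sum_congr rfl fun k _ => hlhs k]
  refine (sum_prod_fiber_eq_coeff s fun a p => e a ^ p * (m p : ℂ)).trans ?_
  have hG : ∀ a, (PowerSeries.mk fun p => e a ^ p * (m p : ℂ) / (p.factorial : ℂ))
      = PowerSeries.rescale (e a) M := by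
    intro a; ext p; simp [M, PowerSeries.coeff_rescale, mul_div_assoc]
  simp_rw [hG]
  -- the generating series of `∑ a, e(a) Z a`; its logarithmic derivative averages `K` over the
  -- roots of unity, which leaves only the coefficients `s - 1, 2 s - 1, …`
  set Q := ∏ a, PowerSeries.rescale (e a) M
  have hD : PowerSeries.derivative ℂ Q
      = (∑ a, PowerSeries.C (e a) * PowerSeries.rescale (e a) K) * Q := by
    refine derivative_prod_of_log _ _ _ fun a => ?_
    rw [hresc, hMK, map_mul, mul_assoc]
  have hL : ∀ q, PowerSeries.coeff q (∑ a, PowerSeries.C (e a) * PowerSeries.rescale (e a) K)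
      = (∑ a, e a ^ (q + 1)) * ((cumulant m (q + 1) : ℂ) / (q.factorial : ℂ)) := by
    intro q
    rw [map_sum, Finset.sum_mul]
    refine Finset.sum_congr rfl fun a _ => ?_
    rw [PowerSeries.coeff_C_mul, PowerSeries.coeff_rescale, PowerSeries.coeff_mk]
    ring
  have he : ∀ q : ℕ, ∑ a, e a ^ q = if (q : ZMod s) = 0 then (s : ℂ) else 0 := by
    intro q
    have := AddChar.sum_mulShift (q : ZMod s) (ZMod.isPrimitive_stdAddChar s)
    rw [ZMod.card] at this
    rw [show (if (q : ZMod s) = 0 then (s : ℂ) else 0)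
      = ((if (q : ZMod s) = 0 then s else 0 : ℕ) : ℂ) by split_ifs <;> simp, ← this]
    refine Finset.sum_congr rfl fun a _ => ?_
    simp only [e]
    rw [← AddChar.map_nsmul_eq_pow, nsmul_eq_mul, mul_comm]
  obtain ⟨t, ht⟩ : ∃ t, s = t + 1 := Nat.exists_eq_succ_of_ne_zero (NeZero.ne s)
  have h0 : PowerSeries.coeff 0 Q = 1 := by
    rw [PowerSeries.coeff_zero_eq_constantCoeff_apply, map_prod]
    refine Finset.prod_eq_one fun a _ => ?_
    rw [← PowerSeries.coeff_zero_eq_constantCoeff_apply, PowerSeries.coeff_rescale]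
    simp [M, hm]
  have h1 : PowerSeries.coeff t (PowerSeries.derivative ℂ Q)
      = s * ((cumulant m s : ℂ) / (t.factorial : ℂ)) := by
    rw [hD, PowerSeries.coeff_mul, Finset.sum_eq_single (t, 0)]
    · rw [h0, hL, he, ← ht]; simp
    · rintro ⟨i, j⟩ hij hne
      rw [Finset.HasAntidiagonal.mem_antidiagonal] at hij
      simp only at hij ⊢
      have hj : j ≠ 0 := by
        rintro rfl; apply hne; simp at hij; simp [hij]
      rw [hL, he, if_neg, zero_mul, zero_mul]
      rw [ZMod.natCast_eq_zero_iff]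
      intro hdvd
      have := Nat.le_of_dvd (by omega) hdvd
      omega
    · simp
  rw [PowerSeries.coeff_derivative, ← ht] at h1
  have h2 : (s.factorial : ℂ) = s * t.factorial := by
    conv_lhs => rw [ht, Nat.factorial_succ]
    rw [ht]; push_cast; ring
  have h3 : ((t : ℂ) + 1) = s := by rw [ht]; push_cast; ring
  rw [h3] at h1
  have hs : (s : ℂ) ≠ 0 := by exact_mod_cast NeZero.ne s
  have h4 := hfac t
  rw [h2]
  calc (s : ℂ) * t.factorial * PowerSeries.coeff s Q
      = t.factorial * (PowerSeries.coeff s Q * s) := by ring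
    _ = _ := by rw [h1]; field_simp

/-! ### Marcinkiewicz' theorem for moment sequences -/

/-- A positivity property of moment sequences: `|E p(Z)²| ≤ E |p(Z)|²` for every complex
polynomial `p`. Unlike being a moment sequence, it passes trivially to pointwise limits. -/
def MomentLike (m : ℕ → ℝ) : Prop :=
  ∀ (K : ℕ) (c : ℕ → ℂ),
    ‖∑ k ∈ Finset.range K, ∑ l ∈ Finset.range K, c k * c l * (m (k + l) : ℂ)‖ ≤
      (∑ k ∈ Finset.range K, ∑ l ∈ Finset.range K,
        c k * (starRingEnd ℂ) (c l) * (m (k + l) : ℂ)).re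

lemma MomentLike.scale {m : ℕ → ℝ} (hm : MomentLike m) (a : ℝ) :
    MomentLike (fun q => a ^ q * m q) := by
  intro K c
  have := hm K (fun k => (a : ℂ) ^ k * c k)
  refine le_of_eq_of_le (congrArg norm ?_) (this.trans_eq (congrArg Complex.re ?_)) <;>
  refine Finset.sum_congr rfl fun k _ => Finset.sum_congr rfl fun l _ => ?_
  · push_cast
    ring
  · simp only [map_mul, map_pow, Complex.conj_ofReal]
    push_cast
    ring

lemma MomentLike.of_tendsto {α : Type*} {l : Filter α} [l.NeBot] {m : α → ℕ → ℝ} {m' : ℕ → ℝ}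
    (h : ∀ q, Tendsto (fun n => m n q) l (𝓝 (m' q))) (hm : ∀ n, MomentLike (m n)) :
    MomentLike m' := by
  intro K c
  have hc : ∀ q, Tendsto (fun n => (m n q : ℂ)) l (𝓝 (m' q : ℂ)) := fun q =>
    (Complex.continuous_ofReal.tendsto _).comp (h q)
  have hsum : ∀ b : ℕ → ℂ, Tendsto (fun n => ∑ k ∈ Finset.range K, ∑ j ∈ Finset.range K,
      c k * b j * (m n (k + j) : ℂ)) l (𝓝 (∑ k ∈ Finset.range K, ∑ j ∈ Finset.range K,
      c k * b j * (m' (k + j) : ℂ))) := fun b =>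
    tendsto_finsetSum _ fun k _ => tendsto_finsetSum _ fun j _ =>
      tendsto_const_nhds.mul (hc (k + j))
  exact le_of_tendsto_of_tendsto (hsum c).norm
    ((Complex.continuous_re.tendsto _).comp (hsum fun j => (starRingEnd ℂ) (c j)))
    (Eventually.of_forall fun n => hm n K c)

lemma momentLike_of_integrable {Ω : Type*} [MeasurableSpace Ω] (μ : Measure Ω) {Z : Ω → ℝ}
    (hZ : ∀ q : ℕ, Integrable (fun ω => Z ω ^ q) μ) :
    MomentLike (fun q => ∫ ω, Z ω ^ q ∂μ) := by
  intro K c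
  have hint : ∀ (a b : ℕ → ℂ) (k l : ℕ),
      Integrable (fun ω => a k * b l * ((Z ω ^ (k + l) : ℝ) : ℂ)) μ := fun a b k l =>
    (hZ (k + l)).ofReal.const_mul _
  have key : ∀ a b : ℕ → ℂ,
      ∑ k ∈ Finset.range K, ∑ l ∈ Finset.range K,
          a k * b l * ((∫ ω, Z ω ^ (k + l) ∂μ : ℝ) : ℂ)
        = ∫ ω, (∑ k ∈ Finset.range K, a k * (Z ω : ℂ) ^ k)
            * (∑ k ∈ Finset.range K, b k * (Z ω : ℂ) ^ k) ∂μ := by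
    intro a b
    have : ∀ ω, (∑ k ∈ Finset.range K, a k * (Z ω : ℂ) ^ k)
            * (∑ k ∈ Finset.range K, b k * (Z ω : ℂ) ^ k)
        = ∑ k ∈ Finset.range K, ∑ l ∈ Finset.range K,
          a k * b l * ((Z ω ^ (k + l) : ℝ) : ℂ) := by
      intro ω
      rw [Finset.sum_mul_sum]
      refine Finset.sum_congr rfl fun k _ => Finset.sum_congr rfl fun l _ => ?_
      push_cast
      ring
    simp_rw [this]
    rw [integral_finsetSum _ fun k _ => integrable_finsetSum _ fun l _ => hint a b k l]
    refine Finset.sum_congr rfl fun k _ => ?_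
    rw [integral_finsetSum _ fun l _ => hint a b k l]
    refine Finset.sum_congr rfl fun l _ => ?_
    rw [integral_const_mul, integral_complex_ofReal]
  rw [key, key c (fun l => (starRingEnd ℂ) (c l))]
  have hconj : ∀ ω, (∑ k ∈ Finset.range K, c k * (Z ω : ℂ) ^ k)
      * (∑ k ∈ Finset.range K, (starRingEnd ℂ) (c k) * (Z ω : ℂ) ^ k)
      = ((‖∑ k ∈ Finset.range K, c k * (Z ω : ℂ) ^ k‖ ^ 2 : ℝ) : ℂ) := by
    intro ω
    push_cast
    rw [← Complex.mul_conj']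
    congr 1
    simp only [map_sum, map_mul, map_pow, Complex.conj_ofReal]
  simp_rw [hconj]
  rw [integral_complex_ofReal, Complex.ofReal_re]
  refine (norm_integral_le_integral_norm _).trans (le_of_eq ?_)
  simp [sq]

/-- A solution of `f' = R f`, `f 0 = 1` has the moments `m` as derivatives at `0` if `R` has the
cumulants of `m` as derivatives at `0`. -/
lemma iteratedDeriv_eq_moment {𝕜 : Type*} [RCLike 𝕜] {m : ℕ → ℝ} (hm : m 0 = 1)
    {f R : 𝕜 → 𝕜} (hf : ContDiff 𝕜 ⊤ f) (hR : ContDiff 𝕜 ⊤ R) (hf0 : f 0 = 1)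
    (hderiv : ∀ z, HasDerivAt f (R z * f z) z)
    (hcum : ∀ i, iteratedDeriv i R 0 = (cumulant m (i + 1) : 𝕜)) (q : ℕ) :
    iteratedDeriv q f 0 = (m q : 𝕜) := by
  induction q using Nat.strong_induction_on with
  | _ q ih =>
    rcases q with _ | q
    · simp [hf0, hm]
    · have : deriv f = fun z => R z * f z := funext fun z => (hderiv z).deriv
      rw [iteratedDeriv_succ', this, iteratedDeriv_fun_mul
        (hR.of_le (by exact_mod_cast le_top)).contDiffAt
        (hf.of_le (by exact_mod_cast le_top)).contDiffAt, moment_succ hm]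
      push_cast
      refine Finset.sum_congr rfl fun i hi => ?_
      rw [hcum, ih _ (by omega)]

/-- The cumulant generating polynomial `∑ κ_k z^k / k!` of a sequence whose cumulants of order
above `d` vanish. -/
noncomputable def cumulantPoly (m : ℕ → ℝ) (d : ℕ) (z : ℂ) : ℂ :=
  ∑ i ∈ Finset.range d, (cumulant m (i + 1) : ℂ) / ((i + 1).factorial : ℂ) * z ^ (i + 1)

lemma hasSum_moment_exp_cumulantPoly {m : ℕ → ℝ} (hm : m 0 = 1) {d : ℕ}
    (hd : ∀ k, d < k → cumulant m k = 0) (z : ℂ) :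
    HasSum (fun q => (m q : ℂ) * (z ^ q / (q.factorial : ℂ))) (Complex.exp (cumulantPoly m d z)) := by
  set R : ℂ → ℂ := fun z => ∑ i ∈ Finset.range d,
    (cumulant m (i + 1) : ℂ) / (i.factorial : ℂ) * z ^ i with hRdef
  have hP : ∀ z, HasDerivAt (cumulantPoly m d) (R z) z := by
    intro z
    unfold cumulantPoly
    refine HasDerivAt.fun_sum fun i _ => ?_
    have := (hasDerivAt_pow (i + 1) z).const_mul
      ((cumulant m (i + 1) : ℂ) / ((i + 1).factorial : ℂ))
    refine this.congr_deriv ?_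
    have h1 : (i.factorial : ℂ) ≠ 0 := by exact_mod_cast i.factorial_ne_zero
    have h2 : ((i : ℂ) + 1) ≠ 0 := by exact_mod_cast i.succ_ne_zero
    rw [Nat.factorial_succ]
    push_cast
    field_simp
  have hRc : ContDiff ℂ ⊤ R := by
    refine ContDiff.sum fun i _ => contDiff_const.mul (contDiff_id.pow i)
  have hPc : ContDiff ℂ ⊤ (cumulantPoly m d) := by
    unfold cumulantPoly
    exact ContDiff.sum fun i _ => contDiff_const.mul (contDiff_id.pow (i + 1))
  have hfc : ContDiff ℂ ⊤ (fun z => Complex.exp (cumulantPoly m d z)) :=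
    Complex.contDiff_exp.comp hPc
  have hcum : ∀ i, iteratedDeriv i R 0 = ((cumulant m (i + 1) : ℝ) : ℂ) := by
    intro i
    rw [hRdef, iteratedDeriv_fun_sum fun j _ =>
      (contDiff_const.mul (contDiff_id.pow j)).contDiffAt]
    simp_rw [iteratedDeriv_const_mul_field, iteratedDeriv_fun_pow_zero]
    by_cases hi : i < d
    · rw [Finset.sum_eq_single_of_mem i (Finset.mem_range.2 hi)]
      · have h1 : (i.factorial : ℂ) ≠ 0 := by exact_mod_cast i.factorial_ne_zero
        simp [h1]
      · intro j _ hj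
        simp [hj.symm]
    · rw [hd (i + 1) (by omega), Finset.sum_eq_zero]
      · simp
      · intro j hj
        have : i ≠ j := by rintro rfl; exact hi (Finset.mem_range.1 hj)
        simp [this]
  have hit := iteratedDeriv_eq_moment (𝕜 := ℂ) hm hfc hRc (by simp [cumulantPoly])
    (fun z => by simpa [mul_comm] using (hP z).cexp) hcum
  have := Complex.hasSum_taylorSeries_of_entire (hfc.differentiable (by simp)) 0 z
  have e : ∀ q : ℕ, ((q.factorial : ℂ))⁻¹ • (z - 0) ^ q •
      iteratedDeriv q (fun z => Complex.exp (cumulantPoly m d z)) 0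
      = (m q : ℂ) * (z ^ q / (q.factorial : ℂ)) := by
    intro q
    rw [hit, sub_zero, smul_eq_mul, smul_eq_mul]
    change _ * (_ * (m q : ℂ)) = _
    ring
  simp_rw [e] at this
  exact this

/-- The series `∑ m_q (w + v)^q / q!` is the limit of the square partial sums of its binomial
expansion, provided that the expansion converges absolutely. -/
lemma tendsto_sum_sum_exp {m : ℕ → ℝ} {w v S : ℂ}
    (habs : Summable fun q => |m q| * ((‖w‖ + ‖v‖) ^ q / (q.factorial : ℝ)))
    (hS : HasSum (fun q => (m q : ℂ) * ((w + v) ^ q / (q.factorial : ℂ))) S) :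
    Tendsto (fun K => ∑ k ∈ Finset.range K, ∑ l ∈ Finset.range K,
      w ^ k / (k.factorial : ℂ) * (v ^ l / (l.factorial : ℂ)) * (m (k + l) : ℂ))
      atTop (𝓝 S) := by
  set G : ℕ × ℕ → ℂ := fun x =>
    w ^ x.1 / (x.1.factorial : ℂ) * (v ^ x.2 / (x.2.factorial : ℂ)) * (m (x.1 + x.2) : ℂ)
  have hbin : ∀ (𝕜 : Type) [RCLike 𝕜] (x y : 𝕜) (q : ℕ),
      ∑ p ∈ Finset.HasAntidiagonal.antidiagonal q,
        x ^ p.1 / (p.1.factorial : 𝕜) * (y ^ p.2 / (p.2.factorial : 𝕜))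
        = (x + y) ^ q / (q.factorial : 𝕜) := by
    intro 𝕜 _ x y q
    have hf : ∀ n : ℕ, (n.factorial : 𝕜) ≠ 0 := fun n => by exact_mod_cast n.factorial_ne_zero
    rw [(Commute.all x y).add_pow', Finset.sum_div]
    refine Finset.sum_congr rfl fun p hp => ?_
    rw [Finset.HasAntidiagonal.mem_antidiagonal] at hp
    have := hf p.1; have := hf p.2; have := hf q
    rw [nsmul_eq_mul, Nat.cast_choose 𝕜 (by omega : p.1 ≤ q), show q - p.1 = p.2 by omega]
    field_simp
  have hsummable : Summable G := by
    rw [← Finset.HasAntidiagonal.sigmaAntidiagonalEquivProd.summable_iff]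
    refine Summable.of_norm ?_
    rw [summable_sigma_of_nonneg fun _ => norm_nonneg _]
    refine ⟨fun q => (hasSum_fintype _).summable, ?_⟩
    convert habs using 2 with q
    rw [tsum_fintype, ← hbin ℝ, Finset.mul_sum, ← Finset.sum_coe_sort
      (Finset.HasAntidiagonal.antidiagonal q)]
    refine Finset.sum_congr rfl fun p _ => ?_
    have hp := Finset.HasAntidiagonal.mem_antidiagonal.1 p.2
    simp only [Function.comp, G, Finset.HasAntidiagonal.sigmaAntidiagonalEquivProd_apply]
    rw [hp]
    simp
    ring
  have hsum : HasSum G S := by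
    have h1 := hsummable.hasSum
    rw [← Finset.HasAntidiagonal.sigmaAntidiagonalEquivProd.hasSum_iff] at h1
    have h2 := h1.sigma fun q => hasSum_fintype _
    have h3 : (fun q => ∑ b : Finset.HasAntidiagonal.antidiagonal q,
        (G ∘ Finset.HasAntidiagonal.sigmaAntidiagonalEquivProd) ⟨q, b⟩)
        = fun q => (m q : ℂ) * ((w + v) ^ q / (q.factorial : ℂ)) := by
      funext q
      rw [← hbin ℂ, Finset.mul_sum, ← Finset.sum_coe_sort
        (Finset.HasAntidiagonal.antidiagonal q)]
      refine Finset.sum_congr rfl fun p _ => ?_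
      have hp := Finset.HasAntidiagonal.mem_antidiagonal.1 p.2
      simp only [Function.comp, G, Finset.HasAntidiagonal.sigmaAntidiagonalEquivProd_apply]
      rw [hp]
      ring
    rw [h3] at h2
    rw [hS.unique h2]
    exact hsummable.hasSum
  have hlim : Tendsto (fun K : ℕ => Finset.range K ×ˢ Finset.range K) atTop atTop := by
    refine tendsto_atTop_finset_of_monotone (fun a b hab => ?_) fun x => ?_
    · exact Finset.product_subset_product (Finset.range_mono hab) (Finset.range_mono hab)
    · exact ⟨x.1 + x.2 + 1, by simp⟩
  have := hsum.comp hlim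
  refine this.congr fun K => ?_
  simp only [Function.comp, Finset.sum_product, G]

/-- The ridge property of the moment generating function `exp ∘ cumulantPoly`. -/
lemma re_cumulantPoly_le {m : ℕ → ℝ} (hm : m 0 = 1) (hpos : MomentLike m) {d : ℕ}
    (hd : ∀ k, d < k → cumulant m k = 0) (z : ℂ) :
    (cumulantPoly m d z).re ≤ (cumulantPoly m d (z.re : ℂ)).re := by
  have hsum := hasSum_moment_exp_cumulantPoly hm hd
  have habs : Summable fun q => |m q| * ((‖z / 2‖ + ‖z / 2‖) ^ q / (q.factorial : ℝ)) := by
    have := (hsum ((‖z / 2‖ + ‖z / 2‖ : ℝ) : ℂ)).summable.norm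
    refine (summable_congr fun q => ?_).1 this
    rw [norm_mul, norm_div, norm_pow, Complex.norm_real, Complex.norm_real, Real.norm_eq_abs,
      Real.norm_eq_abs, abs_of_nonneg (by positivity : 0 ≤ ‖z / 2‖ + ‖z / 2‖),
      Complex.norm_natCast]
  have h1 := tendsto_sum_sum_exp (S := Complex.exp (cumulantPoly m d z)) (w := z / 2) (v := z / 2)
    habs (by simpa [add_halves] using hsum z)
  have hre : z / 2 + (starRingEnd ℂ) (z / 2) = (z.re : ℂ) := by
    rw [Complex.add_conj]; simp; ring
  have h2 := tendsto_sum_sum_exp (S := Complex.exp (cumulantPoly m d (z.re : ℂ))) (w := z / 2)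
    (v := (starRingEnd ℂ) (z / 2)) (by simpa only [RCLike.norm_conj] using habs)
    (by simpa only [hre] using hsum z.re)
  have h3 := le_of_tendsto_of_tendsto h1.norm ((Complex.continuous_re.tendsto _).comp h2)
    (Eventually.of_forall fun K => by
      have := hpos K (fun k => (z / 2) ^ k / (k.factorial : ℂ))
      simpa only [map_div₀, map_pow, map_natCast, Function.comp] using this)
  have h4 : (Complex.exp (cumulantPoly m d (z.re : ℂ))).re
      = Real.exp ((cumulantPoly m d (z.re : ℂ)).re) := by
    have : cumulantPoly m d (z.re : ℂ) = (((cumulantPoly m d (z.re : ℂ)).re : ℝ) : ℂ) := by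
      have hr : cumulantPoly m d (z.re : ℂ) = ((∑ i ∈ Finset.range d,
          cumulant m (i + 1) / ((i + 1).factorial : ℝ) * z.re ^ (i + 1) : ℝ) : ℂ) := by
        simp [cumulantPoly]
      rw [hr, Complex.ofReal_re]
    rw [this, ← Complex.ofReal_exp, Complex.ofReal_re, Complex.ofReal_re]
  rw [Complex.norm_exp, h4] at h3
  exact Real.exp_le_exp.1 h3

lemma top_coeff_nonneg {d : ℕ} {b : ℕ → ℝ}
    (h : ∀ t : ℝ, 0 < t → 0 ≤ ∑ k ∈ Finset.range (d + 1), b k * t ^ k) : 0 ≤ b d := by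
  have hlim : Tendsto (fun u : ℝ => ∑ k ∈ Finset.range (d + 1), b k * u ^ (d - k)) (𝓝[>] 0)
      (𝓝 (∑ k ∈ Finset.range (d + 1), b k * (0 : ℝ) ^ (d - k))) := by
    refine Tendsto.mono_left (Continuous.tendsto ?_ 0) nhdsWithin_le_nhds
    fun_prop
  have h0 : ∑ k ∈ Finset.range (d + 1), b k * (0 : ℝ) ^ (d - k) = b d := by
    rw [Finset.sum_eq_single_of_mem d (by simp)]
    · simp
    · intro k hk hkd
      have : d - k ≠ 0 := by have := Finset.mem_range.1 hk; omega
      simp [this]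
  rw [h0] at hlim
  refine ge_of_tendsto hlim (eventually_mem_nhdsWithin.mono fun u (hu : 0 < u) => ?_)
  have := mul_nonneg (h u⁻¹ (inv_pos.2 hu)) (pow_nonneg hu.le d)
  rw [Finset.sum_mul] at this
  refine this.trans_eq (Finset.sum_congr rfl fun k hk => ?_)
  have hk' : k ≤ d := by have := Finset.mem_range.1 hk; omega
  obtain ⟨e, rfl⟩ := Nat.exists_eq_add_of_le hk'
  rw [Nat.add_sub_cancel_left, pow_add, inv_pow]
  field_simp

/-- **Marcinkiewicz' theorem**: if only finitely many cumulants are nonzero, then those of order at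
least `3` vanish. -/
theorem cumulant_eq_zero_of_momentLike {m : ℕ → ℝ} (hm : m 0 = 1) (hpos : MomentLike m) {d : ℕ}
    (hd : ∀ k, d < k → cumulant m k = 0) {k : ℕ} (hk : 3 ≤ k) : cumulant m k = 0 := by
  -- it suffices to lower the bound `d` by one as long as it is at least `3`
  suffices H : ∀ d, 3 ≤ d → (∀ k, d < k → cumulant m k = 0) → cumulant m d = 0 by
    have hall : ∀ j d, (∀ k, d < k → cumulant m k = 0) → d = j + 2 →
        ∀ k, 3 ≤ k → cumulant m k = 0 := by
      intro j
      induction j with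
      | zero => intro d h hd k hk; exact h k (by omega)
      | succ j ih =>
        intro d h hd
        refine ih (d - 1) (fun k hk => ?_) (by omega)
        rcases eq_or_ne k d with rfl | hne
        · exact H k (by omega) h
        · exact h k (by omega)
    exact hall d (d + 2) (fun k hk => hd k (by omega)) rfl k hk
  clear! d
  intro d hd3 hd
  -- compare the leading terms of both sides of the ridge inequality along the ray of angle `θ`
  have hridge : ∀ θ : ℝ, 0 ≤ cumulant m d * (Real.cos θ ^ d - Real.cos (d * θ)) := by
    intro θ
    have := top_coeff_nonneg (d := d) (b := fun k => if k = 0 then 0 else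
      cumulant m k / (k.factorial : ℝ) * (Real.cos θ ^ k - Real.cos (k * θ))) (by
      intro t ht
      rw [Finset.sum_range_succ']
      have h := re_cumulantPoly_le hm hpos hd (t * Complex.exp (θ * Complex.I))
      have hre : (t * Complex.exp (θ * Complex.I)).re = t * Real.cos θ := by
        rw [Complex.re_ofReal_mul, Complex.exp_ofReal_mul_I_re]
      rw [hre] at h
      simp only [cumulantPoly, Complex.re_sum] at h
      rw [← sub_nonneg, ← Finset.sum_sub_distrib] at h
      simp only [if_true, zero_mul, add_zero, Nat.add_eq_zero_iff, one_ne_zero, and_false, if_false]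
      refine h.trans_eq (Finset.sum_congr rfl fun i _ => ?_)
      have e1 : ((cumulant m (i + 1) : ℂ) / ((i + 1).factorial : ℂ) *
          ((t * Real.cos θ : ℝ) : ℂ) ^ (i + 1)).re
          = cumulant m (i + 1) / ((i + 1).factorial : ℝ) * (t * Real.cos θ) ^ (i + 1) := by
        rw [← Complex.ofReal_re (cumulant m (i + 1) / ((i + 1).factorial : ℝ)
          * (t * Real.cos θ) ^ (i + 1))]
        push_cast
        rfl
      have e2 : ((cumulant m (i + 1) : ℂ) / ((i + 1).factorial : ℂ) *
          (t * Complex.exp (θ * Complex.I)) ^ (i + 1)).re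
          = cumulant m (i + 1) / ((i + 1).factorial : ℝ) * t ^ (i + 1)
            * Real.cos (((i + 1 : ℕ) : ℝ) * θ) := by
        rw [mul_pow, ← Complex.exp_nat_mul]
        have : (((i + 1 : ℕ) : ℂ) * (θ * Complex.I))
            = (((((i + 1 : ℕ) : ℝ) * θ : ℝ)) : ℂ) * Complex.I := by push_cast; ring
        rw [this, ← Complex.exp_ofReal_mul_I_re, ← Complex.re_ofReal_mul]
        congr 1
        push_cast
        ring
      rw [e1, e2]
      ring)
    rw [if_neg (by omega)] at this
    have hf : (0 : ℝ) < d.factorial := by exact_mod_cast d.factorial_pos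
    have h2 := mul_nonneg this hf.le
    refine h2.trans_eq ?_
    field_simp
  have hd0 : (0 : ℝ) < d := by positivity
  have hd3' : (3 : ℝ) ≤ d := by exact_mod_cast hd3
  by_contra hne
  rcases lt_or_gt_of_ne hne with hneg | hpos'
  · -- here `cos (d θ) = -1`, while `cos θ` is nonnegative
    have h := hridge (Real.pi / d)
    rw [mul_div_cancel₀ _ hd0.ne', Real.cos_pi] at h
    have hc : 0 ≤ Real.cos (Real.pi / d) := by
      apply Real.cos_nonneg_of_neg_pi_div_two_le_of_le
      · have := Real.pi_pos; have := div_pos this hd0; linarith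
      · gcongr; linarith
    have := pow_nonneg hc d
    nlinarith
  · -- here `cos (d θ) = 1`, while `|cos θ| < 1` as `d ≥ 3`
    have h := hridge (2 * Real.pi / d)
    rw [mul_div_cancel₀ _ hd0.ne', Real.cos_two_pi] at h
    have hpi := Real.pi_pos
    have hθ0 : 0 < 2 * Real.pi / d := by positivity
    have hθ1 : 2 * Real.pi / d < Real.pi := by
      rw [div_lt_iff₀ hd0]; nlinarith
    have hc1 : Real.cos (2 * Real.pi / d) < 1 := by
      have := Real.cos_lt_cos_of_nonneg_of_le_pi le_rfl hθ1.le hθ0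
      simpa using this
    have hc2 : -1 < Real.cos (2 * Real.pi / d) := by
      have := Real.cos_lt_cos_of_nonneg_of_le_pi hθ0.le le_rfl hθ1
      simpa using this
    have hlt : Real.cos (2 * Real.pi / d) ^ d < 1 := by
      refine (le_abs_self _).trans_lt ?_
      rw [abs_pow]
      exact pow_lt_one₀ (abs_nonneg _) (abs_lt.2 ⟨hc2, hc1⟩) (by omega)
    nlinarith

/-! ### Vanishing high cumulants force a Gaussian limit -/

/-- A common scale `L ≥ 1` for finitely many numbers `c k`, thought of as homogeneous of degree
`k`: either `L = 1` or one of the bounds `|c k| ≤ L ^ k` is attained. -/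
lemma exists_scale (c : ℕ → ℝ) (d : ℕ) : ∃ L : ℝ, 1 ≤ L ∧
    (∀ k, 3 ≤ k → k ≤ d → |c k| ≤ L ^ k) ∧
    (L = 1 ∨ ∃ k, 3 ≤ k ∧ k ≤ d ∧ |c k| = L ^ k) := by
  by_cases h : ∀ k, 3 ≤ k → k ≤ d → |c k| ≤ 1
  · exact ⟨1, le_rfl, by simpa using h, Or.inl rfl⟩
  · push Not at h
    obtain ⟨j, hj3, hjd, hj⟩ := h
    obtain ⟨k, hk, hmax⟩ := (Finset.Icc 3 d).exists_max_image
      (fun k => |c k| ^ ((k : ℝ)⁻¹)) ⟨j, by simp [hj3, hjd]⟩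
    have hpow : ∀ k, 3 ≤ k → (|c k| ^ ((k : ℝ)⁻¹)) ^ k = |c k| := fun k hk3 =>
      Real.rpow_inv_natCast_pow (abs_nonneg _) (by omega)
    have hk' := Finset.mem_Icc.1 hk
    refine ⟨|c k| ^ ((k : ℝ)⁻¹), ?_, fun i hi3 hid => ?_, Or.inr ⟨k, hk'.1, hk'.2,
      (hpow k hk'.1).symm⟩⟩
    · exact (Real.one_le_rpow hj.le (by positivity)).trans (hmax j (by simp [hj3, hjd]))
    · rw [← hpow i hi3]
      exact pow_le_pow_left₀ (by positivity) (hmax i (by simp [hi3, hid])) i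

/-- **Janson's theorem** on cumulants: if all cumulants of sufficiently high order of standardized
variables tend to zero, then so do all cumulants of order at least `3`. After a rescaling that makes
the intermediate cumulants bounded, every limit point is a moment sequence with finitely many
nonzero cumulants, to which Marcinkiewicz' theorem applies. -/
theorem tendsto_cumulant_zero {m : ℕ → ℕ → ℝ} (h0 : ∀ n, m n 0 = 1)
    (h1 : ∀ᶠ n in atTop, m n 1 = 0) (h2 : ∀ᶠ n in atTop, m n 2 = 1)
    (hpos : ∀ n, MomentLike (m n)) {d : ℕ}
    (hd : ∀ k, d < k → Tendsto (fun n => cumulant (m n) k) atTop (𝓝 0))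
    {k : ℕ} (hk : 3 ≤ k) : Tendsto (fun n => cumulant (m n) k) atTop (𝓝 0) := by
  choose L hL1 hLb hLa using fun n => exists_scale (cumulant (m n)) d
  set v : ℕ → ℕ → ℝ := fun n q => (L n)⁻¹ ^ q * m n q with hv
  have hLpos : ∀ n, 0 < L n := fun n => one_pos.trans_le (hL1 n)
  have hcv : ∀ n k, cumulant (v n) k = (L n)⁻¹ ^ k * cumulant (m n) k := fun n k =>
    cumulant_scale _ _ _
  have habs : ∀ n k, |cumulant (v n) k| = |cumulant (m n) k| / (L n) ^ k := fun n k => by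
    rw [hcv, abs_mul, abs_of_nonneg (pow_nonneg (inv_nonneg.2 (hLpos n).le) k), inv_pow,
      inv_mul_eq_div]
  have hle : ∀ n k, |cumulant (v n) k| ≤ |cumulant (m n) k| := fun n k => by
    rw [habs]
    exact div_le_self (abs_nonneg _) (one_le_pow₀ (hL1 n))
  have hdv : ∀ k, d < k → Tendsto (fun n => cumulant (v n) k) atTop (𝓝 0) := fun k hk =>
    squeeze_zero_norm (fun n => hle n k) (by simpa using (hd k hk).abs)
  have hbdd : ∀ k, 1 ≤ k → ∀ᶠ n in atTop, |cumulant (v n) k| ≤ 1 := by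
    intro k hk
    rcases lt_or_ge d k with hdk | hkd
    · have := (hdv k hdk).abs
      rw [abs_zero] at this
      exact this.eventually (ge_mem_nhds one_pos)
    · rcases (by omega : k = 1 ∨ k = 2 ∨ 3 ≤ k) with rfl | rfl | hk3
      · filter_upwards [h1] with n hn
        refine (hle n 1).trans ?_
        rw [cumulant_one, hn]; simp
      · filter_upwards [h1, h2] with n hn hn2
        refine (hle n 2).trans ?_
        rw [cumulant_two, hn, hn2]; simp
      · refine Eventually.of_forall fun n => ?_
        rw [habs]
        exact div_le_one_of_le₀ (hLb n k hk3 hkd) (pow_nonneg (hLpos n).le k)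
  -- along every ultrafilter, all rescaled cumulants converge, to those of a limit sequence `m'`
  have hlim : ∀ k, 3 ≤ k → Tendsto (fun n => cumulant (v n) k) atTop (𝓝 0) := by
    intro k hk
    rw [tendsto_iff_ultrafilter]
    intro U hU
    have hex : ∀ k, ∃ c, 1 ≤ k → Tendsto (fun n => cumulant (v n) k) U (𝓝 c) := by
      intro k
      by_cases hk : 1 ≤ k
      · obtain ⟨x, -, hx⟩ := (isCompact_Icc (a := (-1 : ℝ)) (b := 1)).ultrafilter_le_nhds
          (U.map fun n => cumulant (v n) k) (by
            rw [le_principal_iff]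
            exact hU ((hbdd k hk).mono fun n hn => abs_le.1 hn))
        exact ⟨x, fun _ => hx⟩
      · exact ⟨0, fun h => absurd h hk⟩
    choose c hc using hex
    obtain ⟨m', hm'⟩ := exists_tendsto_moment (l := (U : Filter ℕ)) (m := v)
      (fun n => by simp [hv, h0]) hc
    have hcum : ∀ k, 1 ≤ k → cumulant m' k = c k := fun k hk =>
      tendsto_nhds_unique (tendsto_cumulant hm' k) (hc k hk)
    have hm'0 : m' 0 = 1 := tendsto_nhds_unique (hm' 0) (by simp [hv, h0])
    have hm'pos : MomentLike m' := MomentLike.of_tendsto hm' fun n => (hpos n).scale _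
    have hc0 := cumulant_eq_zero_of_momentLike hm'0 hm'pos (d := d) (fun k hk =>
      tendsto_nhds_unique (tendsto_cumulant hm' k) ((hdv k hk).mono_left hU)) hk
    rw [← hc0]
    exact tendsto_cumulant hm' k
  -- no rescaled cumulant has absolute value `1` in the long run, so there was no rescaling
  have hL : ∀ᶠ n in atTop, L n = 1 := by
    have : ∀ᶠ n in atTop, ∀ k ∈ Finset.Icc 3 d, |cumulant (v n) k| < 1 := by
      rw [Finset.eventually_all]
      intro k hk
      have := (hlim k (Finset.mem_Icc.1 hk).1).abs
      rw [abs_zero] at this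
      exact this.eventually (gt_mem_nhds one_pos)
    filter_upwards [this] with n hn
    rcases hLa n with h | ⟨k, hk3, hkd, hk⟩
    · exact h
    · have := hn k (Finset.mem_Icc.2 ⟨hk3, hkd⟩)
      rw [habs, hk, div_self (pow_pos (hLpos n) k).ne'] at this
      exact absurd this (lt_irrefl _)
  refine (hlim k hk).congr' (hL.mono fun n hn => ?_)
  rw [hcv, hn]; simp

/-- A sequence with the cumulants `0, 1, 0, 0, …` is the moment sequence of `N(0, 1)`. -/
lemma moment_eq_gaussian {m : ℕ → ℝ} (h0 : m 0 = 1) (h1 : cumulant m 1 = 0)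
    (h2 : cumulant m 2 = 1) (h3 : ∀ k, 3 ≤ k → cumulant m k = 0) (q : ℕ) :
    m q = ∫ x : ℝ, x ^ q ∂(gaussianReal 0 1) := by
  have hint : (0 : ℝ) ∈ interior (integrableExpSet id (gaussianReal 0 1)) := by
    rw [integrableExpSet_id_gaussianReal]; simp
  have := iteratedDeriv_mgf_zero hint q
  rw [mgf_id_gaussianReal] at this
  simp only [Pi.pow_apply, id] at this
  rw [← this]
  have hm := iteratedDeriv_eq_moment (𝕜 := ℝ) h0 (f := fun t : ℝ => Real.exp (t ^ 2 / 2))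
    (R := fun t => t) (by fun_prop) contDiff_id (by simp)
    (fun z => by
      have := ((hasDerivAt_pow 2 z).div_const 2).exp
      refine this.congr_deriv ?_
      simp; ring)
    (fun i => by
      rcases (by omega : i = 0 ∨ i = 1 ∨ 2 ≤ i) with rfl | rfl | hi
      · simp [h1]
      · simp [h2, iteratedDeriv_one]
      · obtain ⟨j, rfl⟩ := Nat.exists_eq_add_of_le hi
        rw [h3 _ (by omega), show 2 + j = (j + 1) + 1 by ring, iteratedDeriv_succ']
        simp [iteratedDeriv_const]) q
  simpa using hm.symm

/-! ### The method of moments for the normal law -/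

lemma norm_exp_mul_I_sub_sum_le (n : ℕ) (x : ℝ) :
    ‖Complex.exp (x * Complex.I) - ∑ k ∈ Finset.range n,
      (x * Complex.I) ^ k / (k.factorial : ℂ)‖ ≤ |x| ^ n / (n.factorial : ℝ) := by
  -- it suffices to treat `x ≥ 0`, by complex conjugation
  suffices H : ∀ x : ℝ, 0 ≤ x → ‖Complex.exp (x * Complex.I) - ∑ k ∈ Finset.range n,
      (x * Complex.I) ^ k / (k.factorial : ℂ)‖ ≤ x ^ n / (n.factorial : ℝ) by
    rcases le_total 0 x with hx | hx
    · rw [abs_of_nonneg hx]; exact H x hx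
    · rw [abs_of_nonpos hx]
      refine le_trans (le_of_eq ?_) (H (-x) (by linarith))
      rw [← RCLike.norm_conj]
      congr 1
      simp only [map_sub, map_sum, map_div₀, map_pow, map_mul, Complex.conj_ofReal, Complex.conj_I,
        map_natCast, ← Complex.exp_conj, Complex.ofReal_neg, mul_neg, neg_mul]
  induction n with
  | zero =>
    intro x _
    simp [Complex.norm_exp_ofReal_mul_I]
  | succ n ih =>
    intro x hx
    have hf : ∀ y : ℝ, HasDerivAt (fun y : ℝ => Complex.exp (y * Complex.I) -
        ∑ k ∈ Finset.range (n + 1), (y * Complex.I) ^ k / (k.factorial : ℂ))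
        (Complex.I * (Complex.exp (y * Complex.I) -
        ∑ k ∈ Finset.range n, (y * Complex.I) ^ k / (k.factorial : ℂ))) y := by
      intro y
      have hl : HasDerivAt (fun y : ℝ => (y : ℂ) * Complex.I) Complex.I y := by
        simpa using (Complex.ofRealCLM.hasDerivAt (x := y)).mul_const Complex.I
      simp_rw [Finset.sum_range_succ']
      simp only [pow_zero]
      have hs : HasDerivAt (fun y : ℝ => ∑ k ∈ Finset.range n,
          ((y : ℂ) * Complex.I) ^ (k + 1) / ((k + 1).factorial : ℂ))
          (∑ k ∈ Finset.range n, Complex.I * ((y * Complex.I) ^ k / (k.factorial : ℂ))) y := by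
        refine HasDerivAt.fun_sum fun k _ => ?_
        refine ((hl.pow (k + 1)).div_const _).congr_deriv ?_
        have h1 : (k.factorial : ℂ) ≠ 0 := by exact_mod_cast k.factorial_ne_zero
        have h2 : ((k : ℂ) + 1) ≠ 0 := by exact_mod_cast k.succ_ne_zero
        rw [Nat.factorial_succ]
        push_cast
        field_simp
      refine (hl.cexp.sub (hs.add_const _)).congr_deriv ?_
      rw [← Finset.mul_sum]
      ring
    have hB : ∀ y : ℝ, HasDerivAt (fun y : ℝ => y ^ (n + 1) / ((n + 1).factorial : ℝ))
        (y ^ n / (n.factorial : ℝ)) y := by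
      intro y
      refine ((hasDerivAt_pow (n + 1) y).div_const _).congr_deriv ?_
      have h1 : (n.factorial : ℝ) ≠ 0 := by exact_mod_cast n.factorial_ne_zero
      rw [Nat.factorial_succ]
      push_cast
      field_simp
    refine image_norm_le_of_norm_deriv_right_le_deriv_boundary (a := 0) (b := x)
      (fun y _ => (hf y).continuousAt.continuousWithinAt)
      (fun y _ => (hf y).hasDerivWithinAt) ?_ hB (fun y hy => ?_) ⟨hx, le_rfl⟩
    · rw [Finset.sum_range_succ']
      simp
    · rw [norm_mul, Complex.norm_I, one_mul]
      exact ih y hy.1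

lemma norm_charFun_sub_sum_le {μ : Measure ℝ} [IsProbabilityMeasure μ]
    (hint : ∀ q : ℕ, Integrable (fun x : ℝ => x ^ q) μ) (t : ℝ) (j : ℕ) :
    ‖charFun μ t - ∑ k ∈ Finset.range (2 * j),
      ((∫ x, x ^ k ∂μ : ℝ) : ℂ) * ((t * Complex.I) ^ k / (k.factorial : ℂ))‖
      ≤ (∫ x, x ^ (2 * j) ∂μ) * (t ^ (2 * j) / ((2 * j).factorial : ℝ)) := by
  have hi : ∀ k : ℕ, Integrable
      (fun x : ℝ => ((t * x : ℝ) * Complex.I) ^ k / (k.factorial : ℂ)) μ := by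
    intro k
    have := ((hint k).ofReal (𝕜 := ℂ)).mul_const ((t * Complex.I) ^ k / (k.factorial : ℂ))
    refine this.congr (Eventually.of_forall fun x => ?_)
    simp only [RCLike.ofReal_eq_complex_ofReal]
    push_cast
    ring
  have hsum : ∑ k ∈ Finset.range (2 * j),
      ((∫ x, x ^ k ∂μ : ℝ) : ℂ) * ((t * Complex.I) ^ k / (k.factorial : ℂ))
      = ∫ x, ∑ k ∈ Finset.range (2 * j),
        ((t * x : ℝ) * Complex.I) ^ k / (k.factorial : ℂ) ∂μ := by
    rw [integral_finsetSum _ fun k _ => hi k]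
    refine Finset.sum_congr rfl fun k _ => ?_
    rw [← integral_complex_ofReal, ← integral_mul_const]
    refine integral_congr_ae (Eventually.of_forall fun x => ?_)
    push_cast
    ring
  have he : Integrable (fun x : ℝ => Complex.exp ((t * x : ℝ) * Complex.I)) μ := by
    refine Integrable.of_bound (C := 1) (by fun_prop) (Eventually.of_forall fun x => ?_)
    rw [Complex.norm_exp_ofReal_mul_I]
  have hch : charFun μ t = ∫ x, Complex.exp ((t * x : ℝ) * Complex.I) ∂μ := by
    rw [charFun_apply_real]; push_cast; rfl
  rw [hch, hsum, ← integral_sub he (integrable_finsetSum _ fun k _ => hi k), ← integral_mul_const]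
  refine norm_integral_le_of_norm_le ((hint (2 * j)).mul_const _) (Eventually.of_forall fun x => ?_)
  refine (norm_exp_mul_I_sub_sum_le (2 * j) (t * x)).trans (le_of_eq ?_)
  rw [Even.pow_abs (even_two_mul j), mul_pow]
  ring

/-- **The method of moments** for the standard normal law. -/
theorem tendsto_of_tendsto_moments {μ : ℕ → ProbabilityMeasure ℝ} {γ : ProbabilityMeasure ℝ}
    (hγ : (γ : Measure ℝ) = gaussianReal 0 1)
    (hint : ∀ n (q : ℕ), Integrable (fun x : ℝ => x ^ q) (μ n : Measure ℝ)) {m : ℕ → ℝ}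
    (h0 : m 0 = 1) (h1 : cumulant m 1 = 0)
    (h2 : cumulant m 2 = 1) (h3 : ∀ k, 3 ≤ k → cumulant m k = 0)
    (hlim : ∀ q : ℕ, Tendsto (fun n => ∫ x, x ^ q ∂(μ n : Measure ℝ)) atTop (𝓝 (m q))) :
    Tendsto μ atTop (𝓝 γ) := by
  rw [ProbabilityMeasure.tendsto_iff_tendsto_charFun]
  intro t
  have hL : charFun (gaussianReal 0 1) t = Complex.exp (cumulantPoly m 2 (t * Complex.I)) := by
    rw [charFun_gaussianReal]
    congr 1
    simp only [cumulantPoly, Finset.sum_range_succ, Finset.sum_range_zero, zero_add, h1,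
      Nat.reduceAdd, h2, mul_pow, Complex.I_sq]
    push_cast
    simp [Nat.factorial]
    ring
  have hsum := hasSum_moment_exp_cumulantPoly h0 (d := 2) (fun k hk => h3 k hk)
  have hS := (hsum (t * Complex.I)).tendsto_sum_nat
  have hT : Tendsto (fun j : ℕ => m (2 * j) * (t ^ (2 * j) / ((2 * j).factorial : ℝ)))
      atTop (𝓝 0) := by
    have h := (hsum t).summable.tendsto_atTop_zero
    have h' := (Complex.continuous_re.tendsto _).comp h
    have hmul : Tendsto (fun j : ℕ => 2 * j) atTop atTop :=
      tendsto_id.const_mul_atTop' two_pos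
    refine ((h'.comp hmul).congr fun j => ?_).trans (by simp)
    simp only [Function.comp]
    rw [← Complex.ofReal_re (m (2 * j) * (t ^ (2 * j) / ((2 * j).factorial : ℝ)))]
    push_cast
    rfl
  rw [hγ, hL, Metric.tendsto_atTop']
  intro ε hε
  have hmul : Tendsto (fun j : ℕ => 2 * j) atTop atTop := tendsto_id.const_mul_atTop' two_pos
  -- an even Taylor order `2 * j` makes the remainder bound a moment, not an absolute moment
  obtain ⟨j, hj1, hj2⟩ := ((hT.eventually (gt_mem_nhds (by positivity : 0 < ε / 3))).and
    ((hS.comp hmul).eventually (Metric.ball_mem_nhds _ (by positivity : 0 < ε / 3)))).exists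
  have hA : ∀ᶠ n in atTop, (∫ x, x ^ (2 * j) ∂(μ n : Measure ℝ)) *
      (t ^ (2 * j) / ((2 * j).factorial : ℝ)) < ε / 3 :=
    ((hlim (2 * j)).mul_const _).eventually (gt_mem_nhds hj1)
  have hB : Tendsto (fun n => ∑ k ∈ Finset.range (2 * j),
      ((∫ x, x ^ k ∂(μ n : Measure ℝ) : ℝ) : ℂ) * ((t * Complex.I) ^ k / (k.factorial : ℂ))) atTop
      (𝓝 (∑ k ∈ Finset.range (2 * j), (m k : ℂ) * ((t * Complex.I) ^ k / (k.factorial : ℂ)))) :=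
    tendsto_finsetSum _ fun k _ =>
      ((Complex.continuous_ofReal.tendsto _).comp (hlim k)).mul_const _
  have hB' := hB.eventually (Metric.ball_mem_nhds _ (by positivity : 0 < ε / 3))
  obtain ⟨N, hN⟩ := eventually_atTop.1 (hA.and hB')
  refine ⟨N, fun n hn => ?_⟩
  obtain ⟨ha, hb⟩ := hN n hn.le
  have hc := norm_charFun_sub_sum_le (μ := (μ n : Measure ℝ)) (hint n) t j
  rw [← dist_eq_norm] at hc
  have hj2' : dist (∑ k ∈ Finset.range (2 * j), (m k : ℂ) *
    ((t * Complex.I) ^ k / (k.factorial : ℂ))) _ < ε / 3 := hj2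
  have hb' : dist _ (∑ k ∈ Finset.range (2 * j), (m k : ℂ) *
    ((t * Complex.I) ^ k / (k.factorial : ℂ))) < ε / 3 := hb
  calc dist _ _ ≤ _ := dist_triangle4 _ _ _ _
    _ < ε / 3 + ε / 3 + ε / 3 := add_lt_add (add_lt_add (hc.trans_lt ha) hb') hj2'
    _ = ε := by ring

/-! ### Decoupling under absolute regularity -/

/-- The difference of two integrals of a bounded function is controlled by the maximal difference of
the measures on events. -/
lemma abs_integral_sub_integral_le {E : Type*} [MeasurableSpace E] (κ ν : Measure E)
    [IsProbabilityMeasure κ] [IsProbabilityMeasure ν] {g : E → ℝ} (hg : Measurable g) {A d : ℝ}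
    (hA : ∀ x, |g x| ≤ A) (hd : ∀ B, MeasurableSet B → |κ.real B - ν.real B| ≤ d) :
    |∫ x, g x ∂κ - ∫ x, g x ∂ν| ≤ 2 * A * d := by
  have hA0 : 0 ≤ A := by
    obtain ⟨x⟩ : Nonempty E := nonempty_of_isProbabilityMeasure κ
    exact (abs_nonneg _).trans (hA x)
  -- layer cake for the nonnegative function `g + A ≤ 2 A`
  have hlayer : ∀ (ρ : Measure E) [IsProbabilityMeasure ρ],
      ∫ x, g x ∂ρ = (∫ t in Set.Ioc 0 (2 * A), ρ.real {x | t ≤ g x + A}) - A := by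
    intro ρ _
    have hint : Integrable g ρ := Integrable.of_bound hg.aestronglyMeasurable A
      (Eventually.of_forall hA)
    have h := (show Integrable (fun x => g x + A) ρ from
      hint.add (integrable_const A)).integral_eq_integral_Ioc_meas_le (M := 2 * A)
      (Eventually.of_forall fun x => by
        have := (abs_le.1 (hA x)).1
        simp only [Pi.zero_apply]; linarith)
      (Eventually.of_forall fun x => by
        have := (abs_le.1 (hA x)).2
        dsimp only; linarith)
    rw [integral_add hint (integrable_const A)] at h
    simp only [integral_const, probReal_univ, one_smul] at h
    linarith
  have hmono : ∀ (ρ : Measure E) [IsProbabilityMeasure ρ],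
      IntegrableOn (fun t => ρ.real {x | t ≤ g x + A}) (Set.Ioc 0 (2 * A)) := by
    intro ρ _
    have hanti : Antitone fun t => ρ.real {x | t ≤ g x + A} := fun a b hab =>
      measureReal_mono fun x (hx : b ≤ g x + A) => hab.trans hx
    refine Measure.integrableOn_of_bounded (M := 1) measure_Ioc_lt_top.ne hanti.measurable.aestronglyMeasurable
      (Eventually.of_forall fun t => ?_)
    rw [Real.norm_eq_abs, abs_of_nonneg measureReal_nonneg]
    exact measureReal_le_one
  rw [hlayer κ, hlayer ν, sub_sub_sub_cancel_right, ← integral_sub (hmono κ) (hmono ν)]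
  have := norm_setIntegral_le_of_norm_le_const (μ := volume) (s := Set.Ioc 0 (2 * A)) (C := d)
    (f := fun t => κ.real {x | t ≤ g x + A} - ν.real {x | t ≤ g x + A}) measure_Ioc_lt_top
    (fun t _ => hd _ (measurableSet_le measurable_const (hg.add_const A)))
  rw [Real.norm_eq_abs] at this
  refine this.trans (le_of_eq ?_)
  simp [hA0]
  ring

lemma integrable_of_abs_le {E : Type*} [MeasurableSpace E] (ρ : Measure E) [IsFiniteMeasure ρ]
    {g : E → ℝ} (hg : Measurable g) {A : ℝ} (h : ∀ x, |g x| ≤ A) : Integrable g ρ :=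
  Integrable.of_bound hg.aestronglyMeasurable A (Eventually.of_forall h)

lemma abs_integral_le_of_abs_le {E : Type*} [MeasurableSpace E] (ρ : Measure E)
    [IsProbabilityMeasure ρ] {g : E → ℝ} {A : ℝ} (h : ∀ x, |g x| ≤ A) : |∫ x, g x ∂ρ| ≤ A := by
  simpa using norm_integral_le_of_norm_le_const (μ := ρ) (f := g) (Eventually.of_forall h)

section Mixing

variable {Ω : Type*} [MeasurableSpace Ω] (μ : Measure Ω) [IsProbabilityMeasure μ] {Y : ℕ → Ω → ℝ}

lemma measurable_pastOf (hY : ∀ t, Measurable (Y t)) (k : ℕ) : Measurable (pastOf Y k) :=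
  measurable_pi_lambda _ fun _ => hY _

lemma measurable_futureOf (hY : ∀ t, Measurable (Y t)) (l : ℕ) : Measurable (futureOf Y l) :=
  measurable_pi_lambda _ fun _ => hY _

lemma iSup_abs_sub_le_one {E : Type*} [MeasurableSpace E] (κ ν : Measure E)
    [IsProbabilityMeasure κ] [IsProbabilityMeasure ν] :
    ⨆ (B : Set E) (_ : MeasurableSet B), ENNReal.ofReal |κ.real B - ν.real B| ≤ 1 := by
  refine iSup₂_le fun B _ => ?_
  rw [ENNReal.ofReal_le_one, abs_le]
  have h1 := measureReal_nonneg (μ := κ) (s := B)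
  have h2 := measureReal_nonneg (μ := ν) (s := B)
  have h3 := measureReal_le_one (μ := κ) (s := B)
  have h4 := measureReal_le_one (μ := ν) (s := B)
  constructor <;> linarith

lemma mixingAt_eq (hY : ∀ t, Measurable (Y t)) (k m : ℕ) :
    mixingAt μ Y k m = ∫⁻ ω, ⨆ (B : Set (ℕ → ℝ)) (_ : MeasurableSet B),
      ENNReal.ofReal |(condDistrib (futureOf Y (k + m)) (pastOf Y k) μ (pastOf Y k ω)).real B
        - (μ.map (futureOf Y (k + m))).real B| ∂μ := by
  unfold mixingAt
  refine lintegral_congr fun ω => iSup_congr fun B => iSup_congr fun hB => ?_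
  rw [map_measureReal_apply (measurable_futureOf hY _) hB]

lemma mixingAt_le_one (hY : ∀ t, Measurable (Y t)) (k m : ℕ) : mixingAt μ Y k m ≤ 1 := by
  have := Measure.isProbabilityMeasure_map (μ := μ) (measurable_futureOf hY (k + m)).aemeasurable
  rw [mixingAt_eq μ hY]
  calc _ ≤ ∫⁻ _, 1 ∂μ := lintegral_mono fun ω => iSup_abs_sub_le_one _ _
    _ = 1 := by simp

lemma betaCoeff_nonneg (m : ℕ) : 0 ≤ betaCoeff μ Y m := ENNReal.toReal_nonneg

lemma betaCoeff_le_one (hY : ∀ t, Measurable (Y t)) (m : ℕ) : betaCoeff μ Y m ≤ 1 :=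
  ENNReal.toReal_le_of_le_ofReal zero_le_one
    (by simpa using iSup_le fun k => mixingAt_le_one μ hY k m)

lemma toReal_mixingAt_le (hY : ∀ t, Measurable (Y t)) (k m : ℕ) :
    (mixingAt μ Y k m).toReal ≤ betaCoeff μ Y m := by
  refine ENNReal.toReal_mono (ne_top_of_le_ne_top ENNReal.one_ne_top ?_)
    (le_iSup (fun k => mixingAt μ Y k m) k)
  exact iSup_le fun k => mixingAt_le_one μ hY k m

/-- The past and the future separated by a gap `m` may be made independent at the cost
`2 A β(m)`. -/
lemma abs_integral_past_future_le (hY : ∀ t, Measurable (Y t)) (k m : ℕ)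
    {Φ : (Fin (k + 1) → ℝ) × (ℕ → ℝ) → ℝ} (hΦ : Measurable Φ) {A : ℝ} (hA : ∀ x, |Φ x| ≤ A) :
    |∫ ω, Φ (pastOf Y k ω, futureOf Y (k + m) ω) ∂μ
      - ∫ ω, ∫ ω', Φ (pastOf Y k ω, futureOf Y (k + m) ω') ∂μ ∂μ| ≤ 2 * A * betaCoeff μ Y m := by
  have hA0 : 0 ≤ A := (abs_nonneg _).trans (hA 0)
  have hP := measurable_pastOf hY k
  have hF := measurable_futureOf hY (k + m)
  have := Measure.isProbabilityMeasure_map (μ := μ) hF.aemeasurable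
  have := Measure.isProbabilityMeasure_map (μ := μ) hP.aemeasurable
  set κ := condDistrib (futureOf Y (k + m)) (pastOf Y k) μ with hκ
  set ν := μ.map (futureOf Y (k + m)) with hν
  have ha : ∫ ω, Φ (pastOf Y k ω, futureOf Y (k + m) ω) ∂μ
      = ∫ ω, ∫ y, Φ (pastOf Y k ω, y) ∂(κ (pastOf Y k ω)) ∂μ := by
    rw [← integral_map (φ := fun ω => (pastOf Y k ω, futureOf Y (k + m) ω)) (by fun_prop)
      hΦ.aestronglyMeasurable, ← compProd_map_condDistrib hF.aemeasurable,
      Measure.integral_compProd (integrable_of_abs_le _ hΦ hA)]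
    exact integral_map hP.aemeasurable
      (hΦ.stronglyMeasurable.integral_kernel_prod_right' (κ := κ)).aestronglyMeasurable
  have hb : ∀ ω, ∫ ω', Φ (pastOf Y k ω, futureOf Y (k + m) ω') ∂μ
      = ∫ y, Φ (pastOf Y k ω, y) ∂ν := fun ω =>
    (integral_map hF.aemeasurable
      (hΦ.comp measurable_prodMk_left).aestronglyMeasurable).symm
  simp_rw [ha, hb]
  have hma : Measurable fun ω => ∫ y, Φ (pastOf Y k ω, y) ∂(κ (pastOf Y k ω)) :=
    (hΦ.stronglyMeasurable.integral_kernel_prod_right' (κ := κ)).measurable.comp hP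
  have hmb : Measurable fun ω => ∫ y, Φ (pastOf Y k ω, y) ∂ν :=
    (hΦ.stronglyMeasurable.integral_prod_right' (ν := ν)).measurable.comp hP
  have hia := integrable_of_abs_le μ hma fun ω =>
    abs_integral_le_of_abs_le (κ (pastOf Y k ω)) fun y => hA _
  have hib := integrable_of_abs_le μ hmb fun ω => abs_integral_le_of_abs_le ν fun y => hA _
  rw [← integral_sub hia hib, ← Real.norm_eq_abs]
  refine (norm_integral_le_integral_norm _).trans ?_
  refine (integral_norm_eq_lintegral_enorm (hma.sub hmb).aestronglyMeasurable).trans_le ?_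
  have hmain : ∫⁻ ω, ‖∫ y, Φ (pastOf Y k ω, y) ∂(κ (pastOf Y k ω)) -
      ∫ y, Φ (pastOf Y k ω, y) ∂ν‖ₑ ∂μ ≤ ENNReal.ofReal (2 * A) * mixingAt μ Y k m := by
    rw [mixingAt_eq μ hY, ← lintegral_const_mul' _ _ ENNReal.ofReal_ne_top]
    refine lintegral_mono fun ω => ?_
    have h1 := iSup_abs_sub_le_one (κ (pastOf Y k ω)) ν
    set D := ⨆ (B : Set (ℕ → ℝ)) (_ : MeasurableSet B),
      ENNReal.ofReal |(κ (pastOf Y k ω)).real B - ν.real B| with hD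
    have hDtop : D ≠ ∞ := ne_top_of_le_ne_top ENNReal.one_ne_top h1
    have h2 := abs_integral_sub_integral_le (κ (pastOf Y k ω)) ν
      (g := fun y => Φ (pastOf Y k ω, y)) (hΦ.comp measurable_prodMk_left) (fun y => hA _)
      (d := D.toReal) (fun B hB => by
        rw [← ENNReal.ofReal_le_iff_le_toReal hDtop]
        exact le_iSup₂ (f := fun (B : Set (ℕ → ℝ)) (_ : MeasurableSet B) =>
          ENNReal.ofReal |(κ (pastOf Y k ω)).real B - ν.real B|) B hB)
    rw [← ofReal_norm, Real.norm_eq_abs]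
    refine (ENNReal.ofReal_le_ofReal h2).trans ?_
    rw [ENNReal.ofReal_mul (by positivity), ENNReal.ofReal_toReal hDtop]
  refine (ENNReal.toReal_mono (ENNReal.mul_ne_top ENNReal.ofReal_ne_top
    (ne_top_of_le_ne_top ENNReal.one_ne_top (mixingAt_le_one μ hY k m))) hmain).trans ?_
  rw [ENNReal.toReal_mul, ENNReal.toReal_ofReal (by positivity)]
  exact mul_le_mul_of_nonneg_left (toReal_mixingAt_le μ hY k m) (by positivity)

end Mixing

/-- The sequence that agrees with `x` up to time `k` and with `y` afterwards. -/
def splice (k : ℕ) (x y : ℕ → ℝ) : ℕ → ℝ := fun i => if i ≤ k then x i else y i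

lemma measurable_splice (k : ℕ) : Measurable fun p : (ℕ → ℝ) × (ℕ → ℝ) => splice k p.1 p.2 := by
  refine measurable_pi_lambda _ fun i => ?_
  unfold splice
  split_ifs <;> fun_prop

/-- The sample path `(Y 0 ω, Y 1 ω, …)`. -/
def pathOf {Ω : Type*} (Y : ℕ → Ω → ℝ) (ω : Ω) : ℕ → ℝ := fun i => Y i ω

section Decoupling

variable {Ω : Type*} [MeasurableSpace Ω] (μ : Measure Ω) [IsProbabilityMeasure μ] {Y : ℕ → Ω → ℝ}

lemma measurable_pathOf (hY : ∀ t, Measurable (Y t)) : Measurable (pathOf Y) :=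
  measurable_pi_lambda _ fun _ => hY _

/-- A function of a path that does not look into the gap `(k, k + m)` may be evaluated at two
independent paths spliced at the gap. -/
lemma abs_integral_sub_splice_le (hY : ∀ t, Measurable (Y t)) (k m : ℕ) {G : (ℕ → ℝ) → ℝ}
    (hG : Measurable G) {A : ℝ} (hA : ∀ x, |G x| ≤ A) {T : Set ℕ} (hT : DependsOn G T)
    (hgap : ∀ t ∈ T, t ≤ k ∨ k + m ≤ t) :
    |∫ ω, G (pathOf Y ω) ∂μ - ∫ ω, ∫ ω', G (splice k (pathOf Y ω) (pathOf Y ω')) ∂μ ∂μ|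
      ≤ 2 * A * betaCoeff μ Y m := by
  set J : (Fin (k + 1) → ℝ) × (ℕ → ℝ) → ℕ → ℝ := fun p i =>
    if h : i < k + 1 then p.1 ⟨i, h⟩ else p.2 (i - (k + m)) with hJ
  have hJm : Measurable J := by
    refine measurable_pi_lambda _ fun i => ?_
    simp only [hJ]
    split_ifs <;> fun_prop
  have key : ∀ ω ω', G (J (pastOf Y k ω, futureOf Y (k + m) ω'))
      = G (splice k (pathOf Y ω) (pathOf Y ω')) := by
    intro ω ω'
    refine hT fun i hi => ?_
    simp only [hJ, splice, pathOf, pastOf, futureOf, Nat.lt_succ_iff]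
    split_ifs with h
    · rfl
    · rw [Nat.add_sub_cancel' ((hgap i hi).resolve_left h)]
  have hself : ∀ ω, splice k (pathOf Y ω) (pathOf Y ω) = pathOf Y ω := fun ω => by
    funext i; simp [splice]
  have := abs_integral_past_future_le μ hY k m (hG.comp hJm) (A := A) fun x => hA _
  simp only [Function.comp_apply, key, hself] at this
  exact this

/-- The inductive step for `abs_cov_le`: when `T₁` reaches beyond all of `T₂`, replacing
the part of the path after `T₂` by an independent copy removes points from `T₁`. -/
lemma abs_cov_step (hY : ∀ t, Measurable (Y t)) (m : ℕ) {T₁ T₂ : Finset ℕ} {k : ℕ}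
    (hk : k ∈ T₂) (hkmax : ∀ t ∈ T₂, t ≤ k)
    (hsep : ∀ a ∈ T₁, ∀ b ∈ T₂, a + m ≤ b ∨ b + m ≤ a) {G H : (ℕ → ℝ) → ℝ}
    (hG : Measurable G) (hH : Measurable H) (hG1 : ∀ x, |G x| ≤ 1) (hH1 : ∀ x, |H x| ≤ 1)
    (hGT : DependsOn G (T₁ : Set ℕ)) (hHT : DependsOn H (T₂ : Set ℕ)) {ε : ℝ}
    (ih : ∀ G' : (ℕ → ℝ) → ℝ, Measurable G' → (∀ x, |G' x| ≤ 1) →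
      DependsOn G' ((T₁.filter (· ≤ k) : Finset ℕ) : Set ℕ) →
      |∫ ω, G' (pathOf Y ω) * H (pathOf Y ω) ∂μ
        - (∫ ω, G' (pathOf Y ω) ∂μ) * ∫ ω, H (pathOf Y ω) ∂μ| ≤ ε) :
    |∫ ω, G (pathOf Y ω) * H (pathOf Y ω) ∂μ
        - (∫ ω, G (pathOf Y ω) ∂μ) * ∫ ω, H (pathOf Y ω) ∂μ| ≤ ε + 4 * betaCoeff μ Y m := by
  have hp := measurable_pathOf (Y := Y) hY
  have hgap : ∀ t ∈ T₁, t ≤ k ∨ k + m ≤ t := fun t ht => by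
    rcases hsep t ht k hk with h | h
    · exact Or.inl (by omega)
    · exact Or.inr h
  have hGH1 : ∀ x, |G x * H x| ≤ 1 := fun x => by
    rw [abs_mul]; exact mul_le_one₀ (hG1 x) (abs_nonneg _) (hH1 x)
  -- both `G` and `G * H` may be evaluated at paths spliced at `k`; `H` does not see the splice
  have hcutG := abs_integral_sub_splice_le μ hY k m hG hG1 hGT (by simpa using hgap)
  have hcutGH := abs_integral_sub_splice_le μ hY k m (G := fun x => G x * H x)
    (hG.mul hH) hGH1 (T := T₁ ∪ T₂)
    (fun x y hxy => by
      have h1 : G x = G y := hGT fun i hi => hxy i (Or.inl hi)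
      have h2 : H x = H y := hHT fun i hi => hxy i (Or.inr hi)
      simp only [h1, h2])
    (by
      rintro t (ht | ht)
      · exact hgap t ht
      · exact Or.inl (hkmax t ht))
  have hHs : ∀ ω ω', H (splice k (pathOf Y ω) (pathOf Y ω')) = H (pathOf Y ω) := fun ω ω' =>
    hHT fun i hi => by simp [splice, hkmax i hi]
  simp only [hHs] at hcutGH
  have hspl : Measurable fun q : Ω × Ω => splice k (pathOf Y q.1) (pathOf Y q.2) :=
    (measurable_splice k).comp (hp.prodMap hp)
  have hm1 : Measurable fun q : Ω × Ω => G (splice k (pathOf Y q.1) (pathOf Y q.2)) :=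
    hG.comp hspl
  have hm2 : Measurable fun q : Ω × Ω =>
      G (splice k (pathOf Y q.1) (pathOf Y q.2)) * H (pathOf Y q.1) :=
    hm1.mul (hH.comp (hp.comp measurable_fst))
  have hb2 : ∀ q : Ω × Ω, |G (splice k (pathOf Y q.1) (pathOf Y q.2)) * H (pathOf Y q.1)| ≤ 1 :=
    fun q => by rw [abs_mul]; exact mul_le_one₀ (hG1 _) (abs_nonneg _) (hH1 _)
  rw [integral_integral_swap (integrable_of_abs_le _ hm1 fun q => hG1 _)] at hcutG
  rw [integral_integral_swap (integrable_of_abs_le _ hm2 hb2)] at hcutGH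
  have hi1 : Integrable (fun ω' => ∫ ω, G (splice k (pathOf Y ω) (pathOf Y ω')) ∂μ) μ :=
    (integrable_of_abs_le (μ.prod μ) hm1 fun q => hG1 _).integral_prod_right
  have hi2 : Integrable (fun ω' => ∫ ω, G (splice k (pathOf Y ω) (pathOf Y ω')) *
      H (pathOf Y ω) ∂μ) μ :=
    (integrable_of_abs_le (μ.prod μ) hm2 hb2).integral_prod_right
  set h := ∫ ω, H (pathOf Y ω) ∂μ with hh
  have hh1 : |h| ≤ 1 := abs_integral_le_of_abs_le μ fun ω => hH1 _
  have hmid : |(∫ ω', ∫ ω, G (splice k (pathOf Y ω) (pathOf Y ω')) * H (pathOf Y ω) ∂μ ∂μ)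
      - (∫ ω', ∫ ω, G (splice k (pathOf Y ω) (pathOf Y ω')) ∂μ ∂μ) * h| ≤ ε := by
    rw [← integral_mul_const, ← integral_sub hi2 (hi1.mul_const _)]
    refine abs_integral_le_of_abs_le μ fun ω' => ?_
    refine ih (fun x => G (splice k x (pathOf Y ω'))) ?_ (fun x => hG1 _) fun x y hxy => ?_
    · exact hG.comp ((measurable_splice k).comp (measurable_id.prodMk measurable_const))
    · refine hGT fun i hi => ?_
      simp only [splice]
      split_ifs with hik
      · exact hxy i (by simpa using ⟨hi, hik⟩)
      · rfl
  have hlast : |(∫ ω, G (pathOf Y ω) ∂μ) * h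
      - (∫ ω', ∫ ω, G (splice k (pathOf Y ω) (pathOf Y ω')) ∂μ ∂μ) * h|
      ≤ 2 * 1 * betaCoeff μ Y m := by
    rw [← sub_mul, abs_mul]
    exact (mul_le_of_le_one_right (abs_nonneg _) hh1).trans hcutG
  rw [abs_le] at *
  constructor <;> linarith [hmid.1, hmid.2, hlast.1, hlast.2, hcutGH.1, hcutGH.2]

/-- Functions of two blocks of coordinates at distance at least `m` are almost uncorrelated. The
blocks may interlace; each point costs at most `4 β(m)`. -/
theorem abs_cov_le (hY : ∀ t, Measurable (Y t)) {m : ℕ} (hm : 1 ≤ m) (N : ℕ) :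
    ∀ (T₁ T₂ : Finset ℕ), T₁.card + T₂.card ≤ N →
    (∀ a ∈ T₁, ∀ b ∈ T₂, a + m ≤ b ∨ b + m ≤ a) → ∀ (G H : (ℕ → ℝ) → ℝ),
    Measurable G → Measurable H → (∀ x, |G x| ≤ 1) → (∀ x, |H x| ≤ 1) →
    DependsOn G (T₁ : Set ℕ) → DependsOn H (T₂ : Set ℕ) →
    |∫ ω, G (pathOf Y ω) * H (pathOf Y ω) ∂μ
        - (∫ ω, G (pathOf Y ω) ∂μ) * ∫ ω, H (pathOf Y ω) ∂μ| ≤ 4 * N * betaCoeff μ Y m := by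
  have hconst : ∀ G : (ℕ → ℝ) → ℝ, DependsOn G ((∅ : Finset ℕ) : Set ℕ) → ∀ x, G x = G 0 :=
    fun G hG x => hG fun i hi => absurd hi (by simp)
  have hβ := betaCoeff_nonneg μ (Y := Y) m
  induction N with
  | zero =>
    intro T₁ T₂ hcard _ G H _ _ _ _ hGT _
    have h1 : T₁ = ∅ := Finset.card_eq_zero.1 (by omega)
    subst h1
    simp_rw [hconst G hGT, integral_const_mul]
    simp
  | succ N ih =>
    intro T₁ T₂ hcard hsep G H hG hH hG1 hH1 hGT hHT
    rcases T₁.eq_empty_or_nonempty with rfl | hne₁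
    · simp_rw [hconst G hGT, integral_const_mul]
      simp
      positivity
    rcases T₂.eq_empty_or_nonempty with rfl | hne₂
    · simp_rw [hconst H hHT, integral_mul_const]
      simp
      positivity
    have hcast : 4 * ((N + 1 : ℕ) : ℝ) * betaCoeff μ Y m
        = 4 * N * betaCoeff μ Y m + 4 * betaCoeff μ Y m := by push_cast; ring
    rw [hcast]
    by_cases hlt : ∃ a ∈ T₁, T₂.max' hne₂ < a
    · obtain ⟨a, ha, hka⟩ := hlt
      refine abs_cov_step μ hY m (T₂.max'_mem hne₂) (fun t ht => T₂.le_max' t ht) hsep hG hH hG1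
        hH1 hGT hHT fun G' hG' hG'1 hG'T => ?_
      refine ih _ T₂ ?_ (fun a ha b hb => hsep a (Finset.mem_filter.1 ha).1 b hb) G' H hG' hH
        hG'1 hH1 hG'T hHT
      have : (T₁.filter (· ≤ T₂.max' hne₂)).card < T₁.card :=
        Finset.card_lt_card (Finset.filter_ssubset.2 ⟨a, ha, not_le.2 hka⟩)
      omega
    · push Not at hlt
      -- the last point of `T₂` is beyond `T₁`, so the roles are exchanged
      have hcomm : ∀ ω, G (pathOf Y ω) * H (pathOf Y ω) = H (pathOf Y ω) * G (pathOf Y ω) :=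
        fun ω => mul_comm _ _
      simp_rw [hcomm]
      rw [mul_comm (∫ ω, G (pathOf Y ω) ∂μ)]
      have hsep' : ∀ b ∈ T₂, ∀ a ∈ T₁, b + m ≤ a ∨ a + m ≤ b := fun b hb a ha =>
        (hsep a ha b hb).symm
      have hka : T₁.max' hne₁ < T₂.max' hne₂ := by
        have h1 := hlt _ (T₁.max'_mem hne₁)
        have h2 := hsep _ (T₁.max'_mem hne₁) _ (T₂.max'_mem hne₂)
        omega
      refine abs_cov_step μ hY m (T₁.max'_mem hne₁) (fun t ht => T₁.le_max' t ht) hsep' hH hG hH1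
        hG1 hHT hGT fun H' hH' hH'1 hH'T => ?_
      refine ih _ T₁ ?_ (fun b hb a ha => hsep' b (Finset.mem_filter.1 hb).1 a ha) H' G hH' hG
        hH'1 hG1 hH'T hGT
      have : (T₂.filter (· ≤ T₁.max' hne₁)).card < T₂.card :=
        Finset.card_lt_card (Finset.filter_ssubset.2 ⟨_, T₂.max'_mem hne₂, not_le.2 hka⟩)
      omega

end Decoupling

/-! ### Counting connected tuples -/

section Counting

variable {ι : Type*} (adj : ι → ι → Prop)

/-- A tuple is connected if no proper nonempty subset of its positions is separated from the
remaining ones. -/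
def ConnectedTuple {s : ℕ} (j : Fin s → ι) : Prop :=
  ∀ I : Finset (Fin s), I.Nonempty → I ≠ Finset.univ → ∃ i ∈ I, ∃ i' ∉ I, adj (j i) (j i')

/-- A tuple is a chain if every entry but the first is adjacent to an earlier one. -/
def ChainTuple {s : ℕ} (j : Fin s → ι) : Prop :=
  ∀ i : Fin s, 0 < (i : ℕ) → ∃ i' < i, adj (j i') (j i)

variable {adj}

lemma ConnectedTuple.exists_perm_chain {s : ℕ} (hs : 0 < s) {j : Fin s → ι}
    (hj : ConnectedTuple adj j) : ∃ σ : Equiv.Perm (Fin s), ChainTuple adj (j ∘ σ) := by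
  classical
  suffices H : ∀ t, t + 1 ≤ s → ∃ e : Fin (t + 1) → Fin s, Function.Injective e ∧
      ChainTuple adj (j ∘ e) by
    obtain ⟨t, rfl⟩ := Nat.exists_eq_succ_of_ne_zero hs.ne'
    obtain ⟨e, he, hc⟩ := H t le_rfl
    exact ⟨Equiv.ofBijective e (Finite.injective_iff_bijective.1 he), hc⟩
  intro t
  induction t with
  | zero =>
    intro _
    refine ⟨fun _ => ⟨0, hs⟩, fun a b _ => Subsingleton.elim (α := Fin 1) a b, fun i hi => ?_⟩
    omega
  | succ t ih =>
    intro ht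
    obtain ⟨e, he, hc⟩ := ih (by omega)
    obtain ⟨i, hi, i', hi', hadj⟩ := hj (Finset.univ.image e)
      ⟨e 0, Finset.mem_image_of_mem _ (Finset.mem_univ _)⟩ (fun h => by
        have h1 := congrArg Finset.card h
        rw [Finset.card_image_of_injective _ he] at h1
        simp at h1
        omega)
    obtain ⟨p, -, rfl⟩ := Finset.mem_image.1 hi
    have hne : ∀ q, e q ≠ i' := fun q hq => hi' (Finset.mem_image.2 ⟨q, Finset.mem_univ _, hq⟩)
    refine ⟨Fin.snoc (α := fun _ => Fin s) e i', ?_, ?_⟩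
    · intro a b
      refine Fin.lastCases ?_ (fun a => ?_) a <;> refine Fin.lastCases ?_ (fun b => ?_) b
      · simp
      · simp only [Fin.snoc_last, Fin.snoc_castSucc]
        exact fun h => absurd h.symm (hne b)
      · simp only [Fin.snoc_last, Fin.snoc_castSucc]
        exact fun h => absurd h (hne a)
      · simp only [Fin.snoc_castSucc]
        exact fun h => congrArg _ (he h)
    · intro a
      refine Fin.lastCases (fun _ => ?_) (fun a ha => ?_) a
      · exact ⟨p.castSucc, Fin.castSucc_lt_last p, by simpa using hadj⟩
      · obtain ⟨q, hq, hqa⟩ := hc a (by simpa using ha)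
        exact ⟨q.castSucc, by simpa using hq, by simpa using hqa⟩

variable [Fintype ι]

open Classical in
lemma card_chainTuple_le {D : ℕ} (hD : ∀ x, (Finset.univ.filter fun y => adj x y).card ≤ D)
    {s : ℕ} (t : ℕ) (ht : t ≤ s) :
    (Finset.univ.filter fun j : Fin (t + 1) → ι => ChainTuple adj j).card
      ≤ Fintype.card ι * (s * D) ^ t := by
  induction t with
  | zero =>
    refine (Finset.card_filter_le _ _).trans ?_
    simp
  | succ t ih =>
    set f : (Fin (t + 1 + 1) → ι) → Fin (t + 1) → ι := fun j i => j i.castSucc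
    have himg : (Finset.univ.filter fun j : Fin (t + 1 + 1) → ι => ChainTuple adj j).image f ⊆
        Finset.univ.filter fun j : Fin (t + 1) → ι => ChainTuple adj j := by
      intro l hl
      obtain ⟨j, hj, rfl⟩ := Finset.mem_image.1 hl
      refine Finset.mem_filter.2 ⟨Finset.mem_univ _, fun i hi => ?_⟩
      obtain ⟨i', hi', h⟩ := (Finset.mem_filter.1 hj).2 i.castSucc (by simpa using hi)
      exact ⟨⟨i', lt_trans hi' i.2⟩, hi', h⟩
    have hfib : ∀ l ∈ (Finset.univ.filter fun j : Fin (t + 1 + 1) → ι =>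
        ChainTuple adj j).image f,
        ((Finset.univ.filter fun j : Fin (t + 1 + 1) → ι => ChainTuple adj j).filter
          fun j => f j = l).card ≤ s * D := by
      intro l _
      calc _ ≤ (Finset.univ.biUnion fun i : Fin (t + 1) =>
            Finset.univ.filter fun y => adj (l i) y).card := by
            refine Finset.card_le_card_of_injOn (fun j => j (Fin.last _)) ?_ ?_
            · intro j hj
              obtain ⟨hj1, rfl⟩ := Finset.mem_filter.1 hj
              obtain ⟨i', hi', h⟩ := (Finset.mem_filter.1 hj1).2 (Fin.last _) (by simp)
              simp only [Finset.coe_biUnion, Set.mem_iUnion, Finset.mem_coe, Finset.mem_filter,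
                Finset.mem_univ, true_and, exists_true_left]
              exact ⟨⟨i', hi'⟩, h⟩
            · intro j hj j' hj' h
              obtain ⟨-, hj1⟩ := Finset.mem_filter.1 hj
              obtain ⟨-, hj2⟩ := Finset.mem_filter.1 hj'
              funext i
              refine Fin.lastCases h (fun i => ?_) i
              exact congrFun (hj1.trans hj2.symm) i
        _ ≤ ∑ i : Fin (t + 1), (Finset.univ.filter fun y => adj (l i) y).card :=
            Finset.card_biUnion_le
        _ ≤ ∑ _i : Fin (t + 1), D := Finset.sum_le_sum fun i _ => hD _
        _ = (t + 1) * D := by simp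
        _ ≤ s * D := Nat.mul_le_mul_right _ ht
    calc _ ≤ s * D * _ := Finset.card_le_mul_card_image _ _ hfib
      _ ≤ s * D * (Fintype.card ι * (s * D) ^ t) :=
          Nat.mul_le_mul_left _ ((Finset.card_le_card himg).trans (ih (by omega)))
      _ = _ := by ring

open Classical in
lemma card_connectedTuple_le {D : ℕ} (hD : ∀ x, (Finset.univ.filter fun y => adj x y).card ≤ D)
    (s : ℕ) :
    (Finset.univ.filter fun j : Fin (s + 1) → ι => ConnectedTuple adj j).card
      ≤ (s + 1).factorial * (Fintype.card ι * (s * D) ^ s) := by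
  have hsub : (Finset.univ.filter fun j : Fin (s + 1) → ι => ConnectedTuple adj j) ⊆
      Finset.univ.biUnion fun σ : Equiv.Perm (Fin (s + 1)) =>
        Finset.univ.filter fun j : Fin (s + 1) → ι => ChainTuple adj (j ∘ σ) := by
    intro j hj
    obtain ⟨σ, hσ⟩ := (Finset.mem_filter.1 hj).2.exists_perm_chain (Nat.succ_pos s)
    simp only [Finset.mem_biUnion, Finset.mem_univ, true_and, Finset.mem_filter]
    exact ⟨σ, hσ⟩
  calc _ ≤ _ := Finset.card_le_card hsub
    _ ≤ ∑ σ : Equiv.Perm (Fin (s + 1)),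
        (Finset.univ.filter fun j : Fin (s + 1) → ι => ChainTuple adj (j ∘ σ)).card :=
      Finset.card_biUnion_le
    _ ≤ ∑ _σ : Equiv.Perm (Fin (s + 1)), Fintype.card ι * (s * D) ^ s := by
      refine Finset.sum_le_sum fun σ _ => le_trans ?_ (card_chainTuple_le hD s le_rfl)
      refine Finset.card_le_card_of_injOn (fun j => j ∘ σ) (fun j hj => ?_) ?_
      · simpa using hj
      · exact fun j _ j' _ h => σ.surjective.injective_comp_right h
    _ = _ := by simp [Fintype.card_perm]

end Counting

/-! ### Bounding cumulants of sums with local dependence -/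

lemma norm_prod_sub_prod_le_sum {A : Type*} (S : Finset A) (x z : A → ℂ) (hx : ∀ a, ‖x a‖ ≤ 1)
    (hz : ∀ a, ‖z a‖ ≤ 1) : ‖∏ a ∈ S, x a - ∏ a ∈ S, z a‖ ≤ ∑ a ∈ S, ‖x a - z a‖ := by
  classical
  induction S using Finset.induction_on with
  | empty => simp
  | insert b S hb ih =>
    rw [Finset.prod_insert hb, Finset.prod_insert hb, Finset.sum_insert hb]
    have h1 : ‖∏ a ∈ S, x a‖ ≤ 1 := by
      rw [norm_prod]
      exact Finset.prod_le_one (fun _ _ => norm_nonneg _) fun a _ => hx a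
    calc ‖x b * ∏ a ∈ S, x a - z b * ∏ a ∈ S, z a‖
        = ‖(x b - z b) * ∏ a ∈ S, x a + z b * (∏ a ∈ S, x a - ∏ a ∈ S, z a)‖ := by ring_nf
      _ ≤ ‖x b - z b‖ * ‖∏ a ∈ S, x a‖ + ‖z b‖ * ‖∏ a ∈ S, x a - ∏ a ∈ S, z a‖ := by
          refine (norm_add_le _ _).trans ?_
          rw [norm_mul, norm_mul]
      _ ≤ ‖x b - z b‖ * 1 + 1 * ∑ a ∈ S, ‖x a - z a‖ := by
          gcongr
          exact hz b
      _ = _ := by ring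

/-- The sum over words in Good's formula vanishes if the joint moments factor along a proper
partition: rotating the copies on the positions in `I` alone multiplies the sum by a nontrivial
root of unity. -/
lemma sum_words_eq_zero_of_factor {s : ℕ} [NeZero s] (I : Finset (Fin s)) (hI : I.Nonempty)
    (hI' : I ≠ Finset.univ) (A B : Finset (Fin s) → ℂ) :
    ∑ k : Fin s → ZMod s, (∏ i, (ZMod.stdAddChar (k i) : ℂ)) *
      ∏ a, (A (Finset.univ.filter fun i => k i = a ∧ i ∈ I) *
        B (Finset.univ.filter fun i => k i = a ∧ i ∉ I)) = 0 := by
  set Φ : (Fin s → ZMod s) → ℂ := fun k => (∏ i, (ZMod.stdAddChar (k i) : ℂ)) *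
      ∏ a, (A (Finset.univ.filter fun i => k i = a ∧ i ∈ I) *
        B (Finset.univ.filter fun i => k i = a ∧ i ∉ I)) with hΦ
  set u : Fin s → ZMod s := fun i => if i ∈ I then 1 else 0
  have hshift : ∀ k, Φ (k + u) = ZMod.stdAddChar ((I.card : ℕ) : ZMod s) * Φ k := by
    intro k
    simp only [hΦ, Pi.add_apply, AddChar.map_add_eq_mul, Finset.prod_mul_distrib]
    have h1 : ∏ i, (ZMod.stdAddChar (u i) : ℂ) = ZMod.stdAddChar ((I.card : ℕ) : ZMod s) := by
      rw [Finset.prod_congr rfl (g := fun i => if i ∈ I then (ZMod.stdAddChar (1 : ZMod s) : ℂ) else 1)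
        fun i _ => by simp only [u]; split_ifs <;> simp, Finset.prod_ite_mem, Finset.univ_inter,
        Finset.prod_const, ← AddChar.map_nsmul_eq_pow, nsmul_eq_mul, mul_one]
    have h2 : ∏ a, A (Finset.univ.filter fun i => k i + u i = a ∧ i ∈ I)
        = ∏ a, A (Finset.univ.filter fun i => k i = a ∧ i ∈ I) := by
      rw [← Equiv.prod_comp (Equiv.addRight (1 : ZMod s))]
      refine Finset.prod_congr rfl fun a _ => congrArg A (Finset.filter_congr fun i _ => ?_)
      simp only [Equiv.coe_addRight, u]
      constructor
      · rintro ⟨h, hi⟩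
        simp only [hi, if_true] at h
        exact ⟨add_right_cancel h, hi⟩
      · rintro ⟨h, hi⟩
        simp [hi, h]
    have h3 : ∏ a, B (Finset.univ.filter fun i => k i + u i = a ∧ i ∉ I)
        = ∏ a, B (Finset.univ.filter fun i => k i = a ∧ i ∉ I) := by
      refine Finset.prod_congr rfl fun a _ => congrArg B (Finset.filter_congr fun i _ => ?_)
      refine and_congr_left fun hi => ?_
      simp [u, hi]
    rw [h1, h2, h3]
    ring
  have hsum : ∑ k, Φ k = ZMod.stdAddChar ((I.card : ℕ) : ZMod s) * ∑ k, Φ k := by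
    rw [Finset.mul_sum, ← Equiv.sum_comp (Equiv.addRight u)]
    exact Finset.sum_congr rfl fun k _ => hshift k
  have hne : (ZMod.stdAddChar ((I.card : ℕ) : ZMod s) : ℂ) ≠ 1 := by
    intro h
    rw [← AddChar.map_zero_eq_one (ZMod.stdAddChar (N := s))] at h
    have h0 := ZMod.injective_stdAddChar h
    rw [ZMod.natCast_eq_zero_iff] at h0
    have h1 := Finset.card_pos.2 hI
    have h2 : I.card < s := by
      have := (Finset.card_lt_iff_ne_univ I).2 hI'
      simpa using this
    exact absurd (Nat.le_of_dvd h1 h0) (by omega)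
  have : (1 - (ZMod.stdAddChar ((I.card : ℕ) : ZMod s) : ℂ)) * ∑ k, Φ k = 0 := by
    rw [sub_mul, one_mul, ← hsum, sub_self]
  exact (mul_eq_zero.1 this).resolve_left (sub_ne_zero.2 hne.symm)

section CumulantBound

variable {Ω ι : Type*} [MeasurableSpace Ω] (μ : Measure Ω) [IsProbabilityMeasure μ] [Fintype ι]

/-- Products of moments of a sum expand into joint moments of the summands; this is
multilinearity of the expectation over independent copies. -/
lemma prod_moment_sum_eq {A : Type*} [Fintype A] [DecidableEq A] {y : ι → Ω → ℝ}
    (hy : ∀ j, Measurable (y j)) (hy1 : ∀ j ω, |y j ω| ≤ 1) {s : ℕ} (k : Fin s → A) :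
    ∏ a, ∫ ω, (∑ j, y j ω) ^ (Finset.univ.filter fun i => k i = a).card ∂μ
      = ∑ j : Fin s → ι, ∏ a, ∫ ω, ∏ i with k i = a, y (j i) ω ∂μ := by
  classical
  have hfib : ∀ (z : Fin s → A → ℝ), ∏ a, ∏ i with k i = a, z i a = ∏ i, z i (k i) := by
    intro z
    rw [← Finset.prod_fiberwise (s := Finset.univ) (g := k)]
    refine Finset.prod_congr rfl fun a _ => Finset.prod_congr rfl fun i hi => ?_
    rw [(Finset.mem_filter.1 hi).2]
  have hint : ∀ j : Fin s → ι, Integrable (fun x : A → Ω => ∏ i, y (j i) (x (k i)))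
      (Measure.pi fun _ => μ) := by
    intro j
    refine integrable_of_abs_le _ (A := 1) ?_ fun x => ?_
    · exact Finset.measurable_prod _ fun i _ => (hy _).comp (measurable_pi_apply _)
    · rw [Finset.abs_prod]
      exact Finset.prod_le_one (fun _ _ => abs_nonneg _) fun i _ => hy1 _ _
  calc ∏ a, ∫ ω, (∑ j, y j ω) ^ (Finset.univ.filter fun i => k i = a).card ∂μ
      = ∏ a, ∫ ω, ∏ i with k i = a, ∑ j, y j ω ∂μ := by simp only [Finset.prod_const]
    _ = ∫ x : A → Ω, ∏ a, ∏ i with k i = a, ∑ j, y j (x a) ∂(Measure.pi fun _ => μ) :=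
        (integral_fintype_prod_eq_prod
          (f := fun a ω => ∏ i with k i = a, ∑ j, y j ω) (μ := fun _ => μ)).symm
    _ = ∫ x : A → Ω, ∑ j : Fin s → ι, ∏ i, y (j i) (x (k i)) ∂(Measure.pi fun _ => μ) := by
        refine integral_congr_ae (Eventually.of_forall fun x => ?_)
        dsimp only
        rw [hfib fun i a => ∑ j, y j (x a), Finset.prod_univ_sum, Fintype.piFinset_univ]
    _ = ∑ j : Fin s → ι, ∫ x : A → Ω, ∏ i, y (j i) (x (k i)) ∂(Measure.pi fun _ => μ) :=
        integral_finsetSum _ fun j _ => hint j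
    _ = _ := by
        refine Finset.sum_congr rfl fun j _ => ?_
        rw [← integral_fintype_prod_eq_prod
          (f := fun a ω => ∏ i with k i = a, y (j i) ω) (μ := fun _ => μ)]
        exact integral_congr_ae (Eventually.of_forall fun x =>
          (hfib fun i a => y (j i) (x a)).symm)

open Classical in
/-- A bound for the cumulants of a sum of bounded variables, in terms of the number of connected
index tuples and of the error `ε` made when the joint moments of separated groups of variables are
factored. -/
theorem abs_cumulant_le {y : ι → Ω → ℝ} (hy : ∀ j, Measurable (y j)) (hy1 : ∀ j ω, |y j ω| ≤ 1)
    (adj : ι → ι → Prop) (s : ℕ) (hs : 0 < s) {ε : ℝ} (hε : 0 ≤ ε)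
    (hmix : ∀ (j : Fin s → ι) (I : Finset (Fin s)), (∀ i ∈ I, ∀ i' ∉ I, ¬ adj (j i) (j i')) →
      ∀ S : Finset (Fin s), |∫ ω, ∏ i ∈ S, y (j i) ω ∂μ -
        (∫ ω, ∏ i ∈ S with i ∈ I, y (j i) ω ∂μ) * ∫ ω, ∏ i ∈ S with i ∉ I, y (j i) ω ∂μ| ≤ ε) :
    |cumulant (fun q => ∫ ω, (∑ j, y j ω) ^ q ∂μ) s| ≤ s ^ s *
      ((Finset.univ.filter fun j : Fin s → ι => ConnectedTuple adj j).card
        + s * (Fintype.card ι) ^ s * ε) := by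
  have : NeZero s := ⟨hs.ne'⟩
  set m : ℕ → ℝ := fun q => ∫ ω, (∑ j, y j ω) ^ q ∂μ with hmdef
  have hm0 : m 0 = 1 := by simp [hmdef]
  -- the joint moments and the joint cumulants (up to the factor `s`)
  set M : (Fin s → ι) → Finset (Fin s) → ℂ := fun j S => ((∫ ω, ∏ i ∈ S, y (j i) ω ∂μ : ℝ) : ℂ)
    with hM
  set Γ : (Fin s → ι) → ℂ := fun j => ∑ k : Fin s → ZMod s, (∏ i, (ZMod.stdAddChar (k i) : ℂ)) *
    ∏ a, M j (Finset.univ.filter fun i => k i = a) with hΓ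
  have hM1 : ∀ j S, ‖M j S‖ ≤ 1 := fun j S => by
    rw [hM, Complex.norm_real, Real.norm_eq_abs]
    refine abs_integral_le_of_abs_le μ fun ω => ?_
    rw [Finset.abs_prod]
    exact Finset.prod_le_one (fun _ _ => abs_nonneg _) fun i _ => hy1 _ _
  have hgood : (s : ℂ) * cumulant m s = ∑ j, Γ j := by
    rw [← good_formula s hm0, hΓ, Finset.sum_comm]
    refine Finset.sum_congr rfl fun k _ => ?_
    rw [← Finset.mul_sum]
    congr 1
    have := prod_moment_sum_eq μ hy hy1 k
    have h2 := congrArg (fun x : ℝ => (x : ℂ)) this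
    simp only [Complex.ofReal_prod, Complex.ofReal_sum] at h2
    exact h2
  have hchar : ∀ k : Fin s → ZMod s, ‖∏ i, (ZMod.stdAddChar (k i) : ℂ)‖ = 1 := fun k => by
    rw [norm_prod]
    exact Finset.prod_eq_one fun i _ => AddChar.norm_apply _ _
  have hwords : Fintype.card (Fin s → ZMod s) = s ^ s := by simp [ZMod.card]
  have hconn : ∀ j, ‖Γ j‖ ≤ (s : ℝ) ^ s := fun j => by
    refine (norm_sum_le _ _).trans ?_
    calc _ ≤ ∑ _k : Fin s → ZMod s, (1 : ℝ) := by
          refine Finset.sum_le_sum fun k _ => ?_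
          rw [norm_mul, hchar, one_mul, norm_prod]
          exact Finset.prod_le_one (fun _ _ => norm_nonneg _) fun a _ => hM1 _ _
      _ = _ := by
          rw [Finset.sum_const, Finset.card_univ, hwords]; simp
  have hdisc : ∀ j, ¬ ConnectedTuple adj j → ‖Γ j‖ ≤ (s : ℝ) ^ s * (s * ε) := fun j hj => by
    unfold ConnectedTuple at hj
    push Not at hj
    obtain ⟨I, hI, hI', hsep⟩ := hj
    have h0 := sum_words_eq_zero_of_factor I hI hI' (M j) (M j)
    rw [← sub_zero (Γ j), ← h0, hΓ, ← Finset.sum_sub_distrib]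
    refine (norm_sum_le _ _).trans ?_
    calc _ ≤ ∑ _k : Fin s → ZMod s, (s : ℝ) * ε := by
          refine Finset.sum_le_sum fun k _ => ?_
          rw [← mul_sub, norm_mul, hchar, one_mul]
          refine (norm_prod_sub_prod_le_sum _ _ _ (fun a => hM1 _ _) fun a => ?_).trans ?_
          · rw [norm_mul]
            exact mul_le_one₀ (hM1 _ _) (norm_nonneg _) (hM1 _ _)
          · calc _ ≤ ∑ _a : ZMod s, ε := by
                  refine Finset.sum_le_sum fun a _ => ?_
                  have := hmix j I hsep (Finset.univ.filter fun i => k i = a)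
                  rw [Finset.filter_filter, Finset.filter_filter] at this
                  rw [hM, ← Complex.ofReal_mul, ← Complex.ofReal_sub, Complex.norm_real]
                  exact this
              _ = _ := by
                  rw [Finset.sum_const, Finset.card_univ, ZMod.card, nsmul_eq_mul]
      _ = _ := by
          rw [Finset.sum_const, Finset.card_univ, hwords, nsmul_eq_mul]; push_cast; ring
  have htotal : ‖∑ j, Γ j‖ ≤ (s : ℝ) ^ s *
      ((Finset.univ.filter fun j : Fin s → ι => ConnectedTuple adj j).card
        + s * (Fintype.card ι) ^ s * ε) := by
    refine (norm_sum_le _ _).trans ?_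
    calc ∑ j, ‖Γ j‖ ≤ ∑ j : Fin s → ι, ((if ConnectedTuple adj j then (s : ℝ) ^ s else 0)
          + (s : ℝ) ^ s * (s * ε)) := by
          refine Finset.sum_le_sum fun j _ => ?_
          have h1 : 0 ≤ (s : ℝ) ^ s * (s * ε) := by positivity
          split_ifs with hj
          · linarith [hconn j]
          · linarith [hdisc j hj]
      _ = _ := by
          rw [Finset.sum_add_distrib, ← Finset.sum_filter, Finset.sum_const, Finset.sum_const,
            Finset.card_univ, Fintype.card_fun, Fintype.card_fin, nsmul_eq_mul, nsmul_eq_mul]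
          push_cast
          ring
  rw [← hgood, norm_mul, Complex.norm_natCast, Complex.norm_real, Real.norm_eq_abs] at htotal
  have hs1 : (1 : ℝ) ≤ s := by exact_mod_cast hs
  exact (le_mul_of_one_le_left (abs_nonneg _) hs1).trans htotal

end CumulantBound

/-! ### From cumulants to the limit law -/

/-- Bounded variables that are asymptotically standardized and whose cumulants of high order vanish
asymptotically are asymptotically standard normal, in law and in all moments. -/
theorem gaussian_limit_of_cumulants {Ω : ℕ → Type*} [∀ n, MeasurableSpace (Ω n)]
    (μ : ∀ n, Measure (Ω n)) [∀ n, IsProbabilityMeasure (μ n)] (Z : ∀ n, Ω n → ℝ)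
    (hZ : ∀ n, Measurable (Z n)) (hZb : ∀ n, ∃ C, ∀ ω, |Z n ω| ≤ C)
    (h1 : ∀ᶠ n in atTop, ∫ ω, Z n ω ∂(μ n) = 0) (h2 : ∀ᶠ n in atTop, ∫ ω, Z n ω ^ 2 ∂(μ n) = 1)
    (d : ℕ) (hd : ∀ k, d < k →
      Tendsto (fun n => cumulant (fun q => ∫ ω, Z n ω ^ q ∂(μ n)) k) atTop (𝓝 0)) :
    (∀ k : ℕ, Tendsto (fun n => ∫ ω, Z n ω ^ k ∂(μ n)) atTop
      (𝓝 (∫ x : ℝ, x ^ k ∂(gaussianReal 0 1)))) ∧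
    (∀ x : ℝ, Tendsto (fun n => (μ n).real {ω | Z n ω ≤ x}) atTop
      (𝓝 (cdf (gaussianReal 0 1) x))) := by
  set m : ℕ → ℕ → ℝ := fun n q => ∫ ω, Z n ω ^ q ∂(μ n) with hm
  have hint : ∀ n (q : ℕ), Integrable (fun ω => Z n ω ^ q) (μ n) := fun n q => by
    obtain ⟨C, hC⟩ := hZb n
    refine integrable_of_abs_le _ (A := C ^ q) ((hZ n).pow_const q) fun ω => ?_
    rw [abs_pow]
    exact pow_le_pow_left₀ (abs_nonneg _) (hC ω) q
  have h0 : ∀ n, m n 0 = 1 := fun n => by simp [hm]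
  have h1' : ∀ᶠ n in atTop, m n 1 = 0 := by simpa [hm] using h1
  have hpos : ∀ n, MomentLike (m n) := fun n => momentLike_of_integrable _ (hint n)
  have hc : ∀ k, 1 ≤ k → Tendsto (fun n => cumulant (m n) k) atTop
      (𝓝 (if k = 2 then 1 else 0)) := by
    intro k hk
    rcases (by omega : k = 1 ∨ k = 2 ∨ 3 ≤ k) with rfl | rfl | hk3
    · refine tendsto_const_nhds.congr' ?_
      filter_upwards [h1'] with n hn
      rw [cumulant_one, hn]; simp
    · refine tendsto_const_nhds.congr' ?_
      filter_upwards [h1', h2] with n hn hn2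
      rw [cumulant_two, hn]
      simp [hm, hn2]
    · rw [if_neg (by omega)]
      exact tendsto_cumulant_zero h0 h1' h2 hpos hd hk3
  obtain ⟨m', hm'⟩ := exists_tendsto_moment h0 hc
  have hcum : ∀ k, 1 ≤ k → cumulant m' k = if k = 2 then 1 else 0 := fun k hk =>
    tendsto_nhds_unique (tendsto_cumulant hm' k) (hc k hk)
  have hm'0 : m' 0 = 1 := tendsto_nhds_unique (hm' 0) (by simp [h0])
  have hk1 : cumulant m' 1 = 0 := by simpa using hcum 1 le_rfl
  have hk2 : cumulant m' 2 = 1 := by simpa using hcum 2 (by omega)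
  have hk3 : ∀ k, 3 ≤ k → cumulant m' k = 0 := fun k hk => by
    rw [hcum k (by omega), if_neg (by omega)]
  refine ⟨fun k => ?_, fun x => ?_⟩
  · rw [← moment_eq_gaussian hm'0 hk1 hk2 hk3 k]
    exact hm' k
  · set ν : ℕ → ProbabilityMeasure ℝ := fun n =>
      ⟨(μ n).map (Z n), Measure.isProbabilityMeasure_map (hZ n).aemeasurable⟩ with hν
    set γ : ProbabilityMeasure ℝ := ⟨gaussianReal 0 1, inferInstance⟩ with hγ
    have hνint : ∀ n (q : ℕ), ∫ x, x ^ q ∂(ν n : Measure ℝ) = m n q := fun n q =>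
      integral_map (hZ n).aemeasurable (by fun_prop)
    have hlim : Tendsto ν atTop (𝓝 γ) := by
      refine tendsto_of_tendsto_moments (hγ := rfl) (fun n q => ?_) hm'0 hk1 hk2 hk3 fun q => ?_
      · exact (integrable_map_measure (by fun_prop) (hZ n).aemeasurable).2 (hint n q)
      · simp_rw [hνint]
        exact hm' q
    have hfr : (γ : Measure ℝ) (frontier (Set.Iic x)) = 0 := by
      have := nullSingletonClass_gaussianReal (μ := 0) (v := 1) one_ne_zero
      rw [frontier_Iic]
      change gaussianReal 0 1 {x} = 0
      exact measure_singleton x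
    have h := ProbabilityMeasure.tendsto_measure_of_null_frontier_of_tendsto' hlim hfr
    have h' := (ENNReal.tendsto_toReal (measure_ne_top _ _)).comp h
    rw [cdf_eq_real]
    refine h'.congr fun n => ?_
    change ((μ n).map (Z n) (Set.Iic x)).toReal = _
    rw [Measure.map_apply (hZ n) measurableSet_Iic]
    rfl

/-! ### Cumulants of nonhomogeneous `U`-statistics -/

/-- Two index tuples are close if some of their entries are at distance less than `m`. -/
def CloseIdx {r n : ℕ} (m : ℕ) (j j' : Fin r → Fin n) : Prop :=
  ∃ a b, (j a : ℕ) < j' b + m ∧ (j' b : ℕ) < j a + m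

open Classical in
lemma card_closeIdx_le {r n : ℕ} (m : ℕ) (P : (Fin r → Fin n) → Prop)
    [Fintype {j // P j}] (j : Fin r → Fin n) :
    (Finset.univ.filter fun j' : {j // P j} => CloseIdx m j j'.1).card
      ≤ r * r * (2 * m * n ^ (r - 1)) := by
  set W : Fin r → Finset (Fin n) := fun a =>
    Finset.univ.filter fun v : Fin n => (j a : ℕ) < v + m ∧ (v : ℕ) < j a + m with hW
  have hWc : ∀ a, (W a).card ≤ 2 * m := fun a => by
    calc (W a).card ≤ (Finset.Ico (j a + 1 - m : ℕ) (j a + m)).card := by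
          refine Finset.card_le_card_of_injOn (fun v => (v : ℕ)) (fun v hv => ?_)
            (fun v _ w _ h => Fin.ext h)
          have := (Finset.mem_filter.1 hv).2
          simp only [Finset.coe_Ico, Set.mem_Ico]
          omega
      _ ≤ 2 * m := by rw [Nat.card_Ico]; omega
  have hpi : ∀ a b, (Fintype.piFinset fun c : Fin r => if c = b then W a else Finset.univ).card
      ≤ 2 * m * n ^ (r - 1) := fun a b => by
    rw [Fintype.card_piFinset, ← Finset.mul_prod_erase _ _ (Finset.mem_univ b), if_pos rfl]
    refine Nat.mul_le_mul (hWc a) (le_of_eq ?_)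
    rw [Finset.prod_congr rfl (g := fun _ => n), Finset.prod_const,
      Finset.card_erase_of_mem (Finset.mem_univ b)]
    · simp
    · intro c hc
      rw [if_neg (Finset.ne_of_mem_erase hc)]
      simp
  calc _ ≤ (Finset.univ.biUnion fun p : Fin r × Fin r =>
        Fintype.piFinset fun c : Fin r => if c = p.2 then W p.1 else Finset.univ).card := by
        refine Finset.card_le_card_of_injOn (fun j' => j'.1) (fun j' hj' => ?_)
          (fun _ _ _ _ h => Subtype.ext h)
        obtain ⟨a, b, h⟩ := (Finset.mem_filter.1 hj').2
        simp only [Finset.coe_biUnion, Set.mem_iUnion, Finset.mem_coe, Fintype.mem_piFinset]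
        refine ⟨(a, b), Finset.mem_univ _, fun c => ?_⟩
        split_ifs with hc
        · subst hc
          exact Finset.mem_filter.2 ⟨Finset.mem_univ _, h⟩
        · exact Finset.mem_univ _
    _ ≤ ∑ p : Fin r × Fin r, 2 * m * n ^ (r - 1) :=
        Finset.card_biUnion_le.trans (Finset.sum_le_sum fun p _ => hpi _ _)
    _ = _ := by simp

section UStat

variable {Ω : Type*} [MeasurableSpace Ω] (μ : Measure Ω) [IsProbabilityMeasure μ] {Y : ℕ → Ω → ℝ}

/-- Groups of kernels with no close index tuples are almost uncorrelated. -/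
lemma abs_joint_moment_sub_le (hY : ∀ t, Measurable (Y t)) {m : ℕ} (hm : 1 ≤ m) {r n s : ℕ}
    {g : (Fin r → Fin n) → (Fin r → ℝ) → ℝ} (j : Fin s → Fin r → Fin n)
    (hg : ∀ i, Measurable (g (j i))) (hg1 : ∀ i x, |g (j i) x| ≤ 1)
    (I : Finset (Fin s)) (hI : ∀ i ∈ I, ∀ i' ∉ I, ¬ CloseIdx m (j i) (j i'))
    (S : Finset (Fin s)) :
    |∫ ω, ∏ i ∈ S, g (j i) (fun c => Y (j i c) ω) ∂μ -
        (∫ ω, ∏ i ∈ S with i ∈ I, g (j i) (fun c => Y (j i c) ω) ∂μ) *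
          ∫ ω, ∏ i ∈ S with i ∉ I, g (j i) (fun c => Y (j i c) ω) ∂μ|
      ≤ 4 * (s * r : ℕ) * betaCoeff μ Y m := by
  -- the product over a group of kernels, as a function of the path, and its set of coordinates
  set G : Finset (Fin s) → (ℕ → ℝ) → ℝ := fun R x => ∏ i ∈ R, g (j i) (fun c => x (j i c)) with hG
  set T : Finset (Fin s) → Finset ℕ := fun R =>
    R.biUnion fun i => Finset.univ.image fun c => (j i c : ℕ) with hT
  have hGm : ∀ R, Measurable (G R) := fun R =>
    Finset.measurable_prod _ fun i _ => (hg i).comp (measurable_pi_lambda _ fun c =>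
      measurable_pi_apply _)
  have hG1 : ∀ R x, |G R x| ≤ 1 := fun R x => by
    rw [hG, Finset.abs_prod]
    exact Finset.prod_le_one (fun _ _ => abs_nonneg _) fun i _ => hg1 i _
  have hGT : ∀ R, DependsOn (G R) (T R : Set ℕ) := fun R x y hxy => by
    refine Finset.prod_congr rfl fun i hi => congrArg _ (funext fun c => hxy _ ?_)
    exact Finset.mem_coe.2 (Finset.mem_biUnion.2 ⟨i, hi, Finset.mem_image_of_mem _ (Finset.mem_univ c)⟩)
  have hTc : ∀ R, (T R).card ≤ R.card * r := fun R => by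
    refine Finset.card_biUnion_le_card_mul _ _ _ fun i _ => ?_
    exact Finset.card_image_le.trans (by simp)
  have hcard : (T (S.filter (· ∈ I))).card + (T (S.filter (· ∉ I))).card ≤ s * r := by
    refine (add_le_add (hTc _) (hTc _)).trans ?_
    rw [← add_mul, Finset.card_filter_add_card_filter_not]
    exact Nat.mul_le_mul_right _ (by simpa using Finset.card_le_univ S)
  have hsep : ∀ a ∈ T (S.filter (· ∈ I)), ∀ b ∈ T (S.filter (· ∉ I)), a + m ≤ b ∨ b + m ≤ a := by
    intro a ha b hb
    obtain ⟨i, hi, hia⟩ := Finset.mem_biUnion.1 ha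
    obtain ⟨i', hi', hib⟩ := Finset.mem_biUnion.1 hb
    obtain ⟨c, -, rfl⟩ := Finset.mem_image.1 hia
    obtain ⟨c', -, rfl⟩ := Finset.mem_image.1 hib
    by_contra hcon
    push Not at hcon
    exact hI i (Finset.mem_filter.1 hi).2 i' (Finset.mem_filter.1 hi').2
      ⟨c, c', by omega, by omega⟩
  have h := abs_cov_le μ hY hm (s * r) _ _ hcard hsep (G _) (G _) (hGm _) (hGm _) (hG1 _) (hG1 _)
    (hGT _) (hGT _)
  have hsplit : ∀ x, G (S.filter (· ∈ I)) x * G (S.filter (· ∉ I)) x = G S x := fun x =>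
    Finset.prod_filter_mul_prod_filter_not S (· ∈ I) fun i => g (j i) (fun c => x (j i c))
  simp_rw [hsplit] at h
  exact h

open Classical in
/-- The cumulants of a `U`-statistic with kernels bounded by `1`. -/
theorem abs_cumulant_uStat_le (hY : ∀ t, Measurable (Y t)) {m : ℕ} (hm : 1 ≤ m) {r n : ℕ}
    {g : (Fin r → Fin n) → (Fin r → ℝ) → ℝ} (hg : ∀ j, StrictMono j → Measurable (g j))
    (hg1 : ∀ j, StrictMono j → ∀ x, |g j x| ≤ 1) (s : ℕ) :
    |cumulant (fun q => ∫ ω, uStat g Y ω ^ q ∂μ) (s + 1)| ≤ ((s + 1 : ℕ) : ℝ) ^ (s + 1) *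
      ((s + 1).factorial * (n ^ r * (s * (r * r * (2 * m * n ^ (r - 1)))) ^ s)
        + (s + 1 : ℕ) * (n ^ r) ^ (s + 1) * (4 * ((s + 1) * r : ℕ) * betaCoeff μ Y m)) := by
  set ι := {j : Fin r → Fin n // StrictMono j}
  have hβ := betaCoeff_nonneg μ (Y := Y) m
  have hU : ∀ ω, uStat g Y ω = ∑ j : ι, g j.1 (fun i => Y (j.1 i) ω) := fun ω =>
    (Finset.sum_subtype _ (by simp) _)
  simp_rw [hU]
  have hι : Fintype.card ι ≤ n ^ r := by
    refine (Fintype.card_subtype_le _).trans ?_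
    simp
  refine (abs_cumulant_le μ (y := fun (j : ι) ω => g j.1 (fun i => Y (j.1 i) ω))
    (fun j => (hg _ j.2).comp (measurable_pi_lambda _ fun i => hY _)) (fun j ω => hg1 _ j.2 _)
    (fun j j' => CloseIdx m j.1 j'.1) (s + 1) s.succ_pos
    (ε := 4 * ((s + 1) * r : ℕ) * betaCoeff μ Y m) (by positivity) fun j I hI S => ?_).trans ?_
  · exact abs_joint_moment_sub_le μ hY hm (fun i => (j i).1) (fun i => hg _ (j i).2)
      (fun i => hg1 _ (j i).2) I hI S
  · have h1 := card_connectedTuple_le (adj := fun j j' : ι => CloseIdx m j.1 j'.1)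
      (fun j => card_closeIdx_le m StrictMono j.1) s
    have h2 : ((Finset.univ.filter fun j : Fin (s + 1) → ι =>
        ConnectedTuple (fun j j' : ι => CloseIdx m j.1 j'.1) j).card : ℝ)
        ≤ (s + 1).factorial * (n ^ r * (s * (r * r * (2 * m * n ^ (r - 1)))) ^ s) := by
      have := h1.trans (Nat.mul_le_mul_left _ (Nat.mul_le_mul_right _ hι))
      exact_mod_cast this
    have h3 : (Fintype.card ι : ℝ) ≤ n ^ r := by exact_mod_cast hι
    gcongr

end UStat

/-! ### Size estimates and the limit theorem -/

lemma mul_pow_le_rpow_of_one_le {x Q b : ℝ} {S : ℕ} (hx : 1 ≤ x) (hQ : 0 ≤ Q) (hb : 2 ≤ b * S) :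
    x * Q ^ S ≤ (Q ^ 2 * x ^ b) ^ ((S : ℝ) / 2) := by
  have hx0 : 0 ≤ x := zero_le_one.trans hx
  rw [Real.mul_rpow (by positivity) (by positivity), ← Real.rpow_natCast Q 2, ← Real.rpow_mul hQ,
    ← Real.rpow_mul hx0]
  have h1 : ((2 : ℕ) : ℝ) * ((S : ℝ) / 2) = (S : ℝ) := by push_cast; ring
  rw [h1, Real.rpow_natCast, mul_comm]
  refine mul_le_mul_of_nonneg_left ?_ (by positivity)
  calc x = x ^ (1 : ℝ) := (Real.rpow_one x).symm
    _ ≤ x ^ (b * ((S : ℝ) / 2)) := Real.rpow_le_rpow_of_exponent_le hx (by linarith)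

lemma pow_mul_le_rpow_of_le_one {β R b : ℝ} {S : ℕ} (hβ : 0 ≤ β) (hβ1 : β ≤ 1) (hR : 0 ≤ R)
    (hb0 : 0 ≤ b) (hb : b * S ≤ 2) :
    R ^ S * β ≤ (β ^ b * R ^ 2) ^ ((S : ℝ) / 2) := by
  rw [Real.mul_rpow (by positivity) (by positivity), ← Real.rpow_natCast R 2, ← Real.rpow_mul hR,
    ← Real.rpow_mul hβ]
  have h1 : ((2 : ℕ) : ℝ) * ((S : ℝ) / 2) = (S : ℝ) := by push_cast; ring
  rw [h1, Real.rpow_natCast, mul_comm]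
  refine mul_le_mul_of_nonneg_right ?_ (by positivity)
  calc β = β ^ (1 : ℝ) := (Real.rpow_one β).symm
    _ ≤ β ^ (b * ((S : ℝ) / 2)) :=
      Real.rpow_le_rpow_of_exponent_ge' hβ hβ1 (by positivity) (by linarith)

lemma one_le_of_sq_mul_rpow_lt {x Q b : ℝ} (hx : 0 < x) (hb : b ≤ 2) (h1 : 1 ≤ Q * x)
    (h : Q ^ 2 * x ^ b < 1) : 1 ≤ x := by
  by_contra hlt
  push Not at hlt
  have h2 : x ^ 2 ≤ x ^ b := by
    rw [← Real.rpow_natCast]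
    exact Real.rpow_le_rpow_of_exponent_ge hx hlt.le (by exact_mod_cast hb)
  have h3 : 1 ≤ Q ^ 2 * x ^ 2 := by rw [← mul_pow]; exact one_le_pow₀ h1
  nlinarith [mul_le_mul_of_nonneg_left h2 (sq_nonneg Q)]

/-- The first term of the moment condition dominates `Q ^ 2 * (n / m) ^ b`, where
`Q = F m n ^ (r - 1) / √v`. -/
lemma sq_mul_rpow_le_condition {F v b : ℝ} (hv : 0 < v) (hb : b ≤ 2) {m n r : ℕ} (hm : 1 ≤ m)
    (hn : 1 ≤ n) (hr : 1 ≤ r) :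
    (F * m * n ^ (r - 1) / √v) ^ 2 * ((n : ℝ) / m) ^ b ≤
      F ^ 2 * (m : ℝ) ^ (2 - b) * (n : ℝ) ^ (2 * ((r : ℝ) - 1) + b) * (r : ℝ) ^ (4 - 2 * b) / v := by
  have hm0 : (0 : ℝ) < m := by exact_mod_cast hm
  have hn0 : (0 : ℝ) < n := by exact_mod_cast hn
  have hr1 : (1 : ℝ) ≤ r := by exact_mod_cast hr
  have h1 : (m : ℝ) ^ (2 - b) = m ^ 2 / m ^ b := by
    rw [Real.rpow_sub hm0]; norm_cast
  have h2 : (n : ℝ) ^ (2 * ((r : ℝ) - 1) + b) = (n ^ (r - 1)) ^ 2 * n ^ b := by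
    rw [Real.rpow_add hn0, mul_comm (2 : ℝ), Real.rpow_mul hn0.le, ← Nat.cast_pred hr,
      Real.rpow_natCast]
    norm_cast
  have h3 : (1 : ℝ) ≤ (r : ℝ) ^ (4 - 2 * b) := Real.one_le_rpow hr1 (by linarith)
  rw [h1, h2, Real.div_rpow hn0.le hm0.le, div_pow, Real.sq_sqrt hv.le]
  have hmb : (0 : ℝ) < (m : ℝ) ^ b := Real.rpow_pos_of_pos hm0 b
  have hnb : (0 : ℝ) < (n : ℝ) ^ b := Real.rpow_pos_of_pos hn0 b
  calc (F * m * n ^ (r - 1)) ^ 2 / v * ((n : ℝ) ^ b / (m : ℝ) ^ b)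
      = F ^ 2 * ((m : ℝ) ^ 2 / (m : ℝ) ^ b) * ((n ^ (r - 1)) ^ 2 * (n : ℝ) ^ b) * 1 / v := by ring
    _ ≤ _ := by gcongr

lemma abs_uStat_le {Ω : Type*} {Y : ℕ → Ω → ℝ} {r n : ℕ}
    {f : (Fin r → Fin n) → (Fin r → ℝ) → ℝ} {F : ℝ} (hF : 0 ≤ F)
    (hfF : ∀ j, StrictMono j → ∀ x, |f j x| ≤ F) (ω : Ω) :
    |uStat f Y ω| ≤ F * n ^ r := by
  classical
  unfold uStat
  refine (Finset.abs_sum_le_sum_abs _ _).trans ?_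
  calc _ ≤ ∑ j : Fin r → Fin n with StrictMono j, F :=
        Finset.sum_le_sum fun j hj => hfF j (Finset.mem_filter.1 hj).2 _
    _ = ((Finset.univ.filter fun j : Fin r → Fin n => StrictMono j).card : ℝ) * F := by
        rw [Finset.sum_const, nsmul_eq_mul]
    _ ≤ n ^ r * F := by
        refine mul_le_mul_of_nonneg_right ?_ hF
        have : (Finset.univ.filter fun j : Fin r → Fin n => StrictMono j).card ≤ n ^ r :=
          (Finset.card_le_univ _).trans (by simp)
        exact_mod_cast this
    _ = F * n ^ r := mul_comm _ _

lemma pos_of_variance_uStat_pos {Ω : Type*} [MeasurableSpace Ω] (μ : Measure Ω)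
    {Y : ℕ → Ω → ℝ} {r n : ℕ} {f : (Fin r → Fin n) → (Fin r → ℝ) → ℝ} {F : ℝ}
    (hfF : ∀ j, StrictMono j → ∀ x, |f j x| ≤ F)
    (hv : 0 < variance (uStat f Y) μ) : 0 < F := by
  by_contra hF
  push Not at hF
  have h0 : uStat f Y = fun _ => 0 := by
    funext ω
    unfold uStat
    refine Finset.sum_eq_zero fun j hj => ?_
    have := hfF j (Finset.mem_filter.1 hj).2 (fun i => Y (j i) ω)
    exact abs_eq_zero.1 (le_antisymm (this.trans hF) (abs_nonneg _))
  rw [h0] at hv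
  simp [variance_eq_integral] at hv

section Standardization

variable {Ω : Type*} [MeasurableSpace Ω] (μ : Measure Ω) [IsProbabilityMeasure μ] {Y : ℕ → Ω → ℝ}
  {r n : ℕ} {f : (Fin r → Fin n) → (Fin r → ℝ) → ℝ} {F : ℝ}

lemma measurable_uStat (hY : ∀ t, Measurable (Y t)) (hf : ∀ j, StrictMono j → Measurable (f j)) :
    Measurable (uStat f Y) := by
  unfold uStat
  refine Finset.measurable_sum _ fun j hj => ?_
  exact (hf j (Finset.mem_filter.1 hj).2).comp (measurable_pi_lambda _ fun i => hY _)

lemma variance_uStat_le (hY : ∀ t, Measurable (Y t)) (hf : ∀ j, StrictMono j → Measurable (f j))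
    (hF : 0 ≤ F) (hfF : ∀ j, StrictMono j → ∀ x, |f j x| ≤ F) :
    variance (uStat f Y) μ ≤ (F * n ^ r) ^ 2 := by
  have hm := measurable_uStat hY hf
  refine (variance_le_expectation_sq hm.aestronglyMeasurable).trans ?_
  refine (le_abs_self _).trans (abs_integral_le_of_abs_le μ fun ω => ?_)
  simp only [Pi.pow_apply]
  rw [abs_pow]
  exact pow_le_pow_left₀ (abs_nonneg _) (abs_uStat_le hF hfF ω) 2

/-- A standardized `U`-statistic is a multiple of a `U`-statistic with kernels bounded by `1`. -/
lemma standardize_uStat_eq (hY : ∀ t, Measurable (Y t))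
    (hf : ∀ j, StrictMono j → Measurable (f j)) (hF : 0 < F)
    (hfF : ∀ j, StrictMono j → ∀ x, |f j x| ≤ F) (ω : Ω) :
    standardize μ (uStat f Y) ω = 2 * F / √(variance (uStat f Y) μ) *
      uStat (fun j x => (f j x - ∫ ω', f j (fun i => Y (j i) ω') ∂μ) / (2 * F)) Y ω := by
  classical
  have hint : ∫ ω', uStat f Y ω' ∂μ
      = ∑ j : Fin r → Fin n with StrictMono j, ∫ ω', f j (fun i => Y (j i) ω') ∂μ := by
    unfold uStat
    rw [integral_finsetSum]
    intro j hj
    have hj' := (Finset.mem_filter.1 hj).2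
    exact integrable_of_abs_le μ ((hf j hj').comp (measurable_pi_lambda _ fun i => hY _))
      fun ω => hfF j hj' _
  unfold standardize
  rw [hint]
  have hU : ∀ g : (Fin r → Fin n) → (Fin r → ℝ) → ℝ, uStat g Y ω
      = ∑ j : Fin r → Fin n with StrictMono j, g j (fun i => Y (j i) ω) := fun g => by
    unfold uStat; congr!
  rw [hU, hU, ← Finset.sum_sub_distrib, ← Finset.sum_div]
  field_simp

end Standardization

theorem mainTheorem1 (r : ℕ)
    (Ω : ℕ → Type*) [∀ n, MeasurableSpace (Ω n)]
    (μ : ∀ n, Measure (Ω n)) [∀ n, IsProbabilityMeasure (μ n)]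
    -- `X n t` is the variable with indices `n` and `t + 1`
    (X : ∀ n, ℕ → Ω n → ℝ)
    (hXmeas : ∀ n t, Measurable (X n t))
    (hXstat : ∀ n, StrictlyStationary (μ n) (X n))
    (hXreg : ∀ n, AbsolutelyRegular (μ n) (X n))
    (f : ∀ n, (Fin r → Fin n) → (Fin r → ℝ) → ℝ)
    (hfmeas : ∀ n j, StrictMono j → Measurable (f n j))
    (F : ℕ → ℝ)
    (hfF : ∀ n j, StrictMono j → ∀ x, |f n j x| ≤ F n)
    (m : ℕ → ℕ) (hm : ∀ n, 1 ≤ m n)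
    (hD : ∀ᶠ n in atTop, 0 < variance (uStat (f n) (X n)) (μ n))
    (hcond : ∃ b₀ : ℝ, 0 < b₀ ∧ b₀ ≤ 2 / 3 ∧ ∀ b : ℝ, 0 < b → b ≤ b₀ →
      Tendsto (fun n : ℕ =>
        F n ^ 2 * (m n : ℝ) ^ (2 - b) * (n : ℝ) ^ (2 * ((r : ℝ) - 1) + b) * (r : ℝ) ^ (4 - 2 * b)
            / variance (uStat (f n) (X n)) (μ n)
          + betaCoeff (μ n) (X n) (m n) ^ b
            * (F n ^ 2 * (n : ℝ) ^ (2 * r) / variance (uStat (f n) (X n)) (μ n)))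
        atTop (𝓝 0)) :
    (∀ k : ℕ, Tendsto
      (fun n => ∫ ω, standardize (μ n) (uStat (f n) (X n)) ω ^ k ∂(μ n))
      atTop (𝓝 (∫ x : ℝ, x ^ k ∂(gaussianReal 0 1)))) ∧
    (∀ x : ℝ, Tendsto
      (fun n => (μ n).real {ω | standardize (μ n) (uStat (f n) (X n)) ω ≤ x})
      atTop (𝓝 (cdf (gaussianReal 0 1) x))) := by
  obtain ⟨b₀, hb0, hb23, hcond⟩ := hcond
  set v : ℕ → ℝ := fun n => variance (uStat (f n) (X n)) (μ n) with hv
  set β : ℕ → ℝ := fun n => betaCoeff (μ n) (X n) (m n) with hβ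
  set T₁ : ℝ → ℕ → ℝ := fun b n => F n ^ 2 * (m n : ℝ) ^ (2 - b) *
    (n : ℝ) ^ (2 * ((r : ℝ) - 1) + b) * (r : ℝ) ^ (4 - 2 * b) / v n with hT₁
  set T₂ : ℝ → ℕ → ℝ := fun b n => β n ^ b * (F n ^ 2 * (n : ℝ) ^ (2 * r) / v n) with hT₂
  have hvpos : ∀ᶠ n in atTop, 0 < v n := hD
  have hβ0 : ∀ n, 0 ≤ β n := fun n => betaCoeff_nonneg _ _
  have hβ1 : ∀ n, β n ≤ 1 := fun n => betaCoeff_le_one _ (hXmeas n) _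
  have hT₁0 : ∀ b, ∀ᶠ n in atTop, 0 ≤ T₁ b n := fun b => hvpos.mono fun n hn => by
    simp only [hT₁]; positivity
  have hT₂0 : ∀ b, ∀ᶠ n in atTop, 0 ≤ T₂ b n := fun b => hvpos.mono fun n hn => by
    simp only [hT₂]
    have := Real.rpow_nonneg (hβ0 n) b
    have h2 : (0 : ℝ) ≤ (n : ℝ) ^ (2 * r) := by positivity
    positivity
  have hT₁lim : Tendsto (T₁ b₀) atTop (𝓝 0) :=
    squeeze_zero' (hT₁0 b₀) ((hT₂0 b₀).mono fun n hn => le_add_of_nonneg_right hn)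
      (hcond b₀ hb0 le_rfl)
  have hT₂lim : ∀ b, 0 < b → b ≤ b₀ → Tendsto (T₂ b) atTop (𝓝 0) := fun b hb hb' =>
    squeeze_zero' (hT₂0 b) ((hT₁0 b).mono fun n hn => le_add_of_nonneg_left hn) (hcond b hb hb')
  -- for `r = 0` the statistic is constant, so its variance vanishes
  have hr : 1 ≤ r := by
    by_contra hr0
    have hr0 : r = 0 := by omega
    subst hr0
    obtain ⟨n, hn⟩ := hvpos.exists
    have h0 : uStat (f n) (X n) = fun _ => uStat (f n) (fun _ _ => 0) (0 : ℕ) := by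
      funext ω
      unfold uStat
      exact Finset.sum_congr rfl fun j _ => congrArg _ (Subsingleton.elim _ _)
    simp only [hv] at hn
    rw [h0] at hn
    simp [variance_eq_integral] at hn
  set Z : ∀ n, Ω n → ℝ := fun n => standardize (μ n) (uStat (f n) (X n)) with hZ
  have hZm : ∀ n, Measurable (Z n) := fun n =>
    ((measurable_uStat (hXmeas n) (hfmeas n)).sub_const _).div_const _
  have hUb : ∀ n ω, |uStat (f n) (X n) ω| ≤ |F n| * n ^ r := fun n ω =>
    abs_uStat_le (abs_nonneg _) (fun j hj x => (hfF n j hj x).trans (le_abs_self _)) ω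
  have hUint : ∀ n, Integrable (uStat (f n) (X n)) (μ n) := fun n =>
    integrable_of_abs_le _ (measurable_uStat (hXmeas n) (hfmeas n)) (hUb n)
  refine gaussian_limit_of_cumulants μ Z hZm (fun n => ?_) (Eventually.of_forall fun n => ?_)
    (hvpos.mono fun n hn => ?_) ⌈2 / b₀⌉₊ fun S hS => ?_
  · refine ⟨(|F n| * n ^ r + |F n| * n ^ r) / √(v n), fun ω => ?_⟩
    simp only [hZ, standardize]
    rw [abs_div, abs_of_nonneg (Real.sqrt_nonneg _)]
    refine div_le_div_of_nonneg_right ?_ (Real.sqrt_nonneg _)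
    exact (abs_sub _ _).trans (add_le_add (hUb n ω) (abs_integral_le_of_abs_le _ (hUb n)))
  · simp only [hZ, standardize]
    rw [integral_div, integral_sub (hUint n) (integrable_const _)]
    simp
  · simp only [hZ, standardize, div_pow]
    rw [integral_div, Real.sq_sqrt hn.le,
      ← variance_eq_integral (measurable_uStat (hXmeas n) (hfmeas n)).aemeasurable]
    exact div_self hn.ne'
  -- the cumulants of order `S > 2 / b₀` tend to zero
  have hSb : 2 ≤ b₀ * S := by
    have h1 := Nat.lt_of_ceil_lt hS
    rw [div_lt_iff₀ hb0] at h1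
    linarith
  obtain ⟨s, rfl⟩ : ∃ s, S = s + 1 := Nat.exists_eq_succ_of_ne_zero (by omega)
  -- the exponent for the mixing term has to satisfy `b * S / 2 ≤ 1`, so that
  -- `β ≤ β ^ (b * S / 2)`
  set b : ℝ := min b₀ (2 / (s + 1 : ℕ)) with hbdef
  have hs0 : (0 : ℝ) < (s + 1 : ℕ) := by positivity
  have hb : 0 < b := lt_min hb0 (by positivity)
  have hbs : b * (s + 1 : ℕ) ≤ 2 := by
    have := min_le_right b₀ (2 / ((s + 1 : ℕ) : ℝ))
    rwa [← le_div_iff₀ hs0]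
  set C₁ : ℝ := 2 ^ (s + 1) * ((s + 1 : ℕ) : ℝ) ^ (s + 1) * ((s + 1).factorial *
    (s * (r * r * 2)) ^ s) with hC₁
  set C₂ : ℝ := 2 ^ (s + 1) * ((s + 1 : ℕ) : ℝ) ^ (s + 1) * ((s + 1 : ℕ) * (4 * ((s + 1) * r : ℕ)))
    with hC₂
  have hpow : ∀ T : ℕ → ℝ, Tendsto T atTop (𝓝 0) →
      Tendsto (fun n => T n ^ (((s + 1 : ℕ) : ℝ) / 2)) atTop (𝓝 0) := fun T hT => by
    have := hT.rpow_const (p := ((s + 1 : ℕ) : ℝ) / 2) (Or.inr (by positivity))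
    rwa [Real.zero_rpow (by positivity)] at this
  have hlim : Tendsto (fun n => C₁ * T₁ b₀ n ^ (((s + 1 : ℕ) : ℝ) / 2)
      + C₂ * T₂ b n ^ (((s + 1 : ℕ) : ℝ) / 2)) atTop (𝓝 0) := by
    simpa using ((hpow _ hT₁lim).const_mul C₁).add
      ((hpow _ (hT₂lim b hb (min_le_left _ _))).const_mul C₂)
  refine squeeze_zero_norm' ?_ hlim
  filter_upwards [hvpos, hT₁lim.eventually (gt_mem_nhds one_pos), eventually_ge_atTop 1]
    with n hvn hTn hn1
  have hFn : 0 < F n := pos_of_variance_uStat_pos (μ n) (hfF n) hvn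
  have hsq : 0 < √(v n) := Real.sqrt_pos.2 hvn
  have hm0 : (0 : ℝ) < m n := by exact_mod_cast hm n
  have hn0 : (0 : ℝ) < n := by exact_mod_cast hn1
  set g : (Fin r → Fin n) → (Fin r → ℝ) → ℝ := fun j x =>
    (f n j x - ∫ ω', f n j (fun i => X n (j i) ω') ∂(μ n)) / (2 * F n) with hg
  have hgm : ∀ j, StrictMono j → Measurable (g j) := fun j hj =>
    ((hfmeas n j hj).sub_const _).div_const _
  have hg1 : ∀ j, StrictMono j → ∀ x, |g j x| ≤ 1 := fun j hj x => by
    rw [hg, abs_div, abs_of_pos (by positivity : 0 < 2 * F n), div_le_one (by positivity)]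
    refine (abs_sub _ _).trans ?_
    have h1 := hfF n j hj x
    have h2 := abs_integral_le_of_abs_le (μ n)
      (g := fun ω' => f n j (fun i => X n (j i) ω')) fun ω' => hfF n j hj _
    linarith
  have hmom : (fun q => ∫ ω, Z n ω ^ q ∂(μ n)) = fun q => (2 * F n / √(v n)) ^ q *
      ∫ ω, uStat g (X n) ω ^ q ∂(μ n) := by
    funext q
    rw [← integral_const_mul]
    refine integral_congr_ae (Eventually.of_forall fun ω => ?_)
    dsimp only
    rw [← mul_pow]
    congr 1
    exact standardize_uStat_eq (μ n) (hXmeas n) (hfmeas n) hFn (hfF n) ω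
  rw [hmom, cumulant_scale, Real.norm_eq_abs, abs_mul, abs_of_nonneg (by positivity)]
  have hcum := abs_cumulant_uStat_le (μ n) (hXmeas n) (hm n) hgm hg1 s
  refine (mul_le_mul_of_nonneg_left hcum (by positivity)).trans ?_
  -- the two terms of the bound in terms of `x`, `Q` and `R = Q x`
  set x : ℝ := (n : ℝ) / m n with hx
  set Q : ℝ := F n * m n * n ^ (r - 1) / √(v n) with hQ
  set R : ℝ := F n * n ^ r / √(v n) with hR
  have hx0 : 0 < x := by positivity
  have hQ0 : 0 ≤ Q := by positivity
  have hR0 : 0 ≤ R := by positivity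
  have hnr : (n : ℝ) ^ r = n * n ^ (r - 1) := by
    rw [← pow_succ']; congr 1; omega
  have hQx : Q * x = R := by
    rw [hQ, hx, hR, hnr]; field_simp
  have hR1 : 1 ≤ R := by
    rw [hR, one_le_div hsq]
    exact Real.sqrt_le_iff.2 ⟨by positivity,
      variance_uStat_le (μ n) (hXmeas n) (hfmeas n) hFn.le (hfF n)⟩
  have hQT : Q ^ 2 * x ^ b₀ ≤ T₁ b₀ n :=
    sq_mul_rpow_le_condition hvn (by linarith) (hm n) hn1 hr
  -- `m n ≤ n` eventually, since the variance is at most `(F n * n ^ r) ^ 2`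
  have hx1 : 1 ≤ x := one_le_of_sq_mul_rpow_lt hx0 (by linarith) (hQx ▸ hR1) (hQT.trans_lt hTn)
  have hfirst : x * Q ^ (s + 1) ≤ T₁ b₀ n ^ (((s + 1 : ℕ) : ℝ) / 2) :=
    (mul_pow_le_rpow_of_one_le hx1 hQ0 hSb).trans
      (Real.rpow_le_rpow (by positivity) hQT (by positivity))
  have hsecond : R ^ (s + 1) * β n ≤ T₂ b n ^ (((s + 1 : ℕ) : ℝ) / 2) := by
    refine (pow_mul_le_rpow_of_le_one (hβ0 n) (hβ1 n) hR0 hb.le hbs).trans (le_of_eq ?_)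
    congr 1
    simp only [hT₂, hR]
    rw [div_pow, Real.sq_sqrt hvn.le, mul_pow, ← pow_mul, mul_comm r 2]
  calc _ = C₁ * (x * Q ^ (s + 1)) + C₂ * (R ^ (s + 1) * β n) := by
        rw [hC₁, hC₂, hx, hQ, hR, hnr]
        simp only [div_pow, mul_pow, pow_succ]
        field_simp
        ring
    _ ≤ _ := by gcongr
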